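/- **Setting.** Let $E$ be a Polish space with its Borel $\sigma$-algebra, let $D_E$ be the set of right-continuous paths $\omega:[0,\infty)\to E$ with left limits, $X_t(\omega)=\omega(t)$, and equip $D_E$ with the Borel $\sigma$-algebra of the Skorokhod topology, i.e. the $\sigma$-algebra generated by the coordinate maps $X_t$. Let $\mathfrak P$ be the set of probability measures on $D_E$, with the Borel $\sigma$-algebra of weak convergence, i.e. the one generated by $\mu\mapsto\mu[A]$, $A\in\mathcal B(D_E)$. A subset of a Polish (or standard Borel) space $X$ is *analytic* if it is the projection of a Borel subset of $X\times\mathbb R$; the *universal* $\sigma$-algebra on $X$ is the intersection of the $\mu$-completions of the Borel $\sigma$-algebra over all probability measures $\mu$. A function $f:X\to[-\infty,\infty]$ is *lower semi-analytic* if $\{f<a\}$ is analytic for every $a\in\mathbb R$. For an extended real random variable $Y$ on $D_E$ we set $E^\mu[Y]=E^\mu[Y^+]-E^\mu[Y^-]$, with the convention $E^\mu[Y]=\infty$ as soon as $E^\mu[Y^+]=\infty$. A *random time* is a Borel map $\tau:D_E\to[0,\infty]$; $X_\tau(\omega)=X_{\tau(\omega)}(\omega)$ where $\tau(\omega)<\infty$.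 The *concatenation* $\omega*_\tau\omega'\in D_E$ is given by $X_t(\omega*_\tau\omega')=X_t(\omega)$ for $t<\tau(\omega)$, and, for $t\ge\tau(\omega)$, by one of the following two rules, fixed once and for all: (i) $X_t(\omega*_\tau\omega')=X_\tau(\omega)+X_{t-\tau(\omega)}(\omega')-X_0(\omega')$, if $E$ is a topological abelian group; (ii) $X_t(\omega*_\tau\omega')=X_{t-\tau(\omega)}(\omega')$, for an arbitrary Polish space $E$. (The two rules agree when $X_0(\omega')=X_\tau(\omega)$; the theorem holds for each of them.) A *kernel* is a map $x\mapsto\nu_x$ from $E$ to $\mathfrak P$ such that $x\mapsto\nu_x[A]$ is universally measurable for each $A\in\mathcal B(D_E)$. For $\mu\in\mathfrak P$, a random time $\tau$ and a kernel $\nu$ the law $\mu*_\tau\nu\in\mathfrak P$ is defined by $$(\mu*_\tau\nu)[A]=\iint 1_A(\omega*_\tau\omega')\,\nu_{X_\tau(\omega)}(d\omega')\,\mu(d\omega),\qquad A\in\mathcal B(D_E),$$ where the inner integral is $1_A(\omega)$ if $\tau(\omega)=\infty$. Let $\mathcal P=(\mathcal P^x)_{x\in E}$ be a family of nonempty subsets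 of $\mathfrak P$ and $\mathcal T$ a set of random times. A *$\mathcal P$-selector* is a kernel $\nu$ with $\nu_x\in\mathcal P^x$ for all $x\in E$; $\mathcal S(\mathcal P)$ is the set of all of them. $(\mathcal P,\mathcal T)$ is a *controlled Markov family* if the graph $\{(x,\mu):\mu\in\mathcal P^x\}$ is an analytic subset of $E\times\mathfrak P$, and $\mu*_\tau\nu\in\mathcal P^x$ for all $x\in E$, $\mu\in\mathcal P^x$, $\tau\in\mathcal T$, $\nu\in\mathcal S(\mathcal P)$. $(\mathcal P,\mathcal T,G)$ is a *Markov control problem* if, in addition, $G:D_E\to[-\infty,\infty]$ is universally measurable and $E^\mu[G^-]<\infty$ for all $\mu\in\bigcup_x\mathcal P^x$. Its *value function* is $v(x)=\inf_{\mu\in\mathcal P^x}E^\mu[G]$. A measure $\mu\in\mathcal P^x$ is *$\varepsilon$-optimal* at $x$ if $E^\mu[G]<v(x)+\varepsilon$, with the convention $-\infty+\varepsilon=-1/\varepsilon$; if $v(x)=\infty$, then every $\mu\in\mathcal P^x$ (for which necessarily $E^\mu[G]=\infty$) is regarded as $\varepsilon$-optimal. $G$ is *$(\mathcal P,\mathcal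 T)$-approximately disintegrable* if - $G$ is a tail random variable: it is Borel measurable, $E^\mu[G^-]<\infty$ for all $\mu\in\bigcup_x\mathcal P^x$, and for all $x\in E$, $\mu\in\mathcal P^x$, $\nu\in\mathcal S(\mathcal P)$, $\tau\in\mathcal T$ we have $E^{\mu*_\tau\nu}[G]=E^\mu\big[g(X_\tau)1_{\{\tau<\infty\}}+G\,1_{\{\tau=\infty\}}\big]$, where $g(y)=E^{\nu_y}[G]$; and - for all $x\in E$, $\mu\in\mathcal P^x$, $\tau\in\mathcal T$ and $\varepsilon>0$ there is $\nu\in\mathcal S(\mathcal P)$ with $E^{\mu*_\tau\nu}[G]\le E^\mu[G]+\varepsilon$. **Theorem (an abstract dynamic programming principle).** Let $(\mathcal P,\mathcal T,G)$ be a Markov control problem with $G$ $(\mathcal P,\mathcal T)$-approximately disintegrable, and let $v$ be its value function. Then: 1. $v$ is lower semi-analytic and, hence, universally measurable. 2. For each $\varepsilon>0$ there is a selector $\hat\nu\in\mathcal S(\mathcal P)$ such that $\hat\nu_x$ is $\varepsilon$-optimal at $x$ for every $x\in E$. 3. For all $\tau\in\mathcal T$ and $x\in E$, $$v(x)=\inf_{\mu\in\mathcal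 P^x}E^\mu\big[v(X_\tau)1_{\{\tau<\infty\}}+G\,1_{\{\tau=\infty\}}\big].$$ -/

import Mathlib

open MeasureTheory Filter Topology
open scoped NNReal ENNReal

set_option linter.unusedSectionVars false

noncomputable section

namespace DPP

/-! ### Descriptive set theory -/

/-- A subset of a (standard Borel) space `X` is analytic if it is the projection on `X` of a
Borel subset of `X × ℝ`. -/
def IsAnalytic {X : Type*} [MeasurableSpace X] (A : Set X) : Prop :=
  ∃ B : Set (X × ℝ), MeasurableSet B ∧ A = Prod.fst '' B

/-- On a Polish space with its Borel sets this is the notion of Mathlib. -/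
theorem isAnalytic_iff_analyticSet {X : Type*} [TopologicalSpace X] [PolishSpace X]
    [MeasurableSpace X] [BorelSpace X] (A : Set X) : IsAnalytic A ↔ AnalyticSet A := by
  constructor
  · rintro ⟨B, hB, rfl⟩
    exact hB.analyticSet.image_of_continuous continuous_fst
  · intro h
    rw [AnalyticSet] at h
    rcases h with rfl | ⟨f, hf, rfl⟩
    · exact ⟨∅, MeasurableSet.empty, by simp⟩
    · obtain ⟨e, he⟩ := exists_measurableEmbedding_real (ℕ → ℕ)
      have hm : MeasurableEmbedding (fun z => (f z, e z)) :=
        (hf.measurable.prodMk he.measurable).measurableEmbedding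
          (fun a b hab => he.injective (Prod.ext_iff.1 hab).2)
      refine ⟨Set.range fun z => (f z, e z), hm.measurableSet_range, ?_⟩
      ext x
      simp

/-- Members of the universal `σ`-algebra: the sets that belong to the `μ`-completion of the given
`σ`-algebra for every probability measure `μ`. -/
def UniversallyMeasurableSet {X : Type*} [MeasurableSpace X] (A : Set X) : Prop :=
  ∀ (μ : Measure X) [IsProbabilityMeasure μ], NullMeasurableSet A μ

/-- Measurability with respect to the universal `σ`-algebra. -/
def UniversallyMeasurable {X Y : Type*} [MeasurableSpace X] [MeasurableSpace Y]
    (f : X → Y) : Prop :=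
  ∀ ⦃B : Set Y⦄, MeasurableSet B → UniversallyMeasurableSet (f ⁻¹' B)

/-- Lower semi-analytic: all strict sub-level sets at real levels are analytic. -/
def LowerSemianalytic {X : Type*} [MeasurableSpace X] (f : X → EReal) : Prop :=
  ∀ a : ℝ, IsAnalytic {x | f x < (a : EReal)}

/-! ### Expectations of extended real random variables -/

/-- `E^μ[Y] = E^μ[Y⁺] - E^μ[Y⁻]`, with the convention that `E^μ[Y] = ∞` as soon as
`E^μ[Y⁺] = ∞`. -/
def expect {Ω : Type*} [MeasurableSpace Ω] (μ : ProbabilityMeasure Ω) (Y : Ω → EReal) : EReal :=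
  open Classical in
  if ∫⁻ ω, (Y ω).toENNReal ∂(μ : Measure Ω) = ∞ then ⊤
  else ((∫⁻ ω, (Y ω).toENNReal ∂(μ : Measure Ω) : ℝ≥0∞) : EReal)
    - ((∫⁻ ω, (-(Y ω)).toENNReal ∂(μ : Measure Ω) : ℝ≥0∞) : EReal)

/-- `E^μ[G⁻] < ∞`. -/
def LowerSemiIntegrable {Ω : Type*} [MeasurableSpace Ω] (μ : ProbabilityMeasure Ω)
    (G : Ω → EReal) : Prop :=
  ∫⁻ ω, (-(G ω)).toENNReal ∂(μ : Measure Ω) < ∞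

/-! ### Path space -/

section Paths

variable (E : Type*) [TopologicalSpace E]

/-- The space `D_E` of right-continuous paths `[0, ∞) → E` with left limits (in `E`). -/
structure Path where
  toFun : ℝ≥0 → E
  rcll : ∀ t, ContinuousWithinAt toFun (Set.Ici t) t ∧ ∃ l, Tendsto toFun (𝓝[<] t) (𝓝 l)

instance : CoeFun (Path E) (fun _ => ℝ≥0 → E) := ⟨Path.toFun⟩

/-- The `σ`-algebra generated by the coordinate maps, which for Polish `E` is the Borel
`σ`-algebra of the Skorokhod topology. Laws on `D_E` form `ProbabilityMeasure (Path E)`, with the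
`σ`-algebra generated by the evaluations `μ ↦ μ A`, which for Polish `E` is the Borel `σ`-algebra
of weak convergence. -/
instance [MeasurableSpace E] : MeasurableSpace (Path E) :=
  MeasurableSpace.comap (fun ω : Path E => (ω : ℝ≥0 → E)) MeasurableSpace.pi

/-- A random time: a Borel map `D_E → [0, ∞]`. -/
structure RandomTime [MeasurableSpace E] where
  toFun : Path E → ℝ≥0∞
  measurable : Measurable toFun

instance [MeasurableSpace E] : CoeFun (RandomTime E) (fun _ => Path E → ℝ≥0∞) :=
  ⟨RandomTime.toFun⟩

/-- A universally measurable kernel `x ↦ ν_x` from `E` to the laws on `D_E`. -/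
structure UKernel [MeasurableSpace E] where
  toFun : E → ProbabilityMeasure (Path E)
  measurable : ∀ A : Set (Path E), MeasurableSet A →
    UniversallyMeasurable fun x => (toFun x : Measure (Path E)) A

instance [MeasurableSpace E] : CoeFun (UKernel E) (fun _ => E → ProbabilityMeasure (Path E)) :=
  ⟨UKernel.toFun⟩

/-- The two ways to attach a path at a point: keep it as it is (this makes sense in every state
space), or, for a topological abelian group structure on the state space, translate it so that it
starts at that point. -/
inductive Pasting : Type _
  | replace : Pasting
  | translate (g : AddCommGroup E) (h : IsTopologicalAddGroup E) : Pasting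

end Paths

variable {E : Type*} [TopologicalSpace E]

/-- The state that the new piece contributes if the old piece stopped at `a`, the new one started
at `b` and is now at `z`: it is `z`, or `a + z - b`. -/
def Pasting.glue : Pasting E → E → E → E → E
  | .replace, _, _, z => z
  | .translate _ _, a, b, z => a + z - b

theorem Pasting.continuous_glue (c : Pasting E) (a b : E) : Continuous (c.glue a b) := by
  cases c with
  | replace => exact continuous_id
  | translate g h => exact (continuous_const.add continuous_id).sub continuous_const

theorem Pasting.continuous_glue_uncurry (c : Pasting E) :
    Continuous fun p : E × E × E => c.glue p.1 p.2.1 p.2.2 := by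
  cases c with
  | replace => exact continuous_snd.snd
  | translate g h => exact (continuous_fst.add continuous_snd.snd).sub continuous_snd.fst

/-- The position `X_τ(ω)`. It is meaningful, and used, on `{τ < ∞}` only. -/
def posAt (τ : Path E → ℝ≥0∞) (ω : Path E) : E := ω (τ ω).toNNReal

theorem rcll_concat (c : Pasting E) (s : ℝ≥0∞) (ω ω' : Path E) (t : ℝ≥0) :
    ContinuousWithinAt
      (fun t : ℝ≥0 => if (t : ℝ≥0∞) < s then ω t
        else c.glue (ω s.toNNReal) (ω' 0) (ω' (t - s.toNNReal))) (Set.Ici t) t ∧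
    ∃ l, Tendsto
      (fun t : ℝ≥0 => if (t : ℝ≥0∞) < s then ω t
        else c.glue (ω s.toNNReal) (ω' 0) (ω' (t - s.toNNReal))) (𝓝[<] t) (𝓝 l) := by
  have hopen : IsOpen {u : ℝ≥0 | (u : ℝ≥0∞) < s} :=
    isOpen_lt ENNReal.continuous_coe continuous_const
  have hleft : ((t : ℝ≥0∞) ≤ s) → ∃ l, Tendsto
      (fun t : ℝ≥0 => if (t : ℝ≥0∞) < s then ω t
        else c.glue (ω s.toNNReal) (ω' 0) (ω' (t - s.toNNReal))) (𝓝[<] t) (𝓝 l) := by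
    intro hts
    obtain ⟨l, hl⟩ := (ω.rcll t).2
    refine ⟨l, hl.congr' ?_⟩
    filter_upwards [self_mem_nhdsWithin] with u hu
    have : (u : ℝ≥0∞) < s := lt_of_lt_of_le (by exact_mod_cast hu) hts
    simp [this]
  by_cases h : (t : ℝ≥0∞) < s
  · refine ⟨?_, hleft h.le⟩
    refine ((ω.rcll t).1).congr_of_eventuallyEq ?_ (by simp [h])
    filter_upwards [mem_nhdsWithin_of_mem_nhds (hopen.mem_nhds h)] with u hu
    have hu' : (u : ℝ≥0∞) < s := hu
    simp [hu']
  · have hs : s ≠ ∞ := fun hs => h (hs ▸ ENNReal.coe_lt_top)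
    lift s to ℝ≥0 using hs
    have hst : s ≤ t := by simpa using h
    simp only [ENNReal.coe_lt_coe, ENNReal.toNNReal_coe] at *
    refine ⟨?_, ?_⟩
    · have h1 : ContinuousWithinAt (fun u : ℝ≥0 => ω' (u - s)) (Set.Ici t) t := by
        refine ContinuousWithinAt.comp (t := Set.Ici (t - s)) (ω'.rcll (t - s)).1 ?_ ?_
        · exact (continuous_id.sub continuous_const).continuousWithinAt
        · intro u hu
          exact tsub_le_tsub_right hu s
      have h2 := ((c.continuous_glue (ω s) (ω' 0)).continuousAt).comp_continuousWithinAt h1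
      refine h2.congr ?_ (by simp [hst])
      intro u hu
      have : ¬ u < s := not_lt.2 (hst.trans hu)
      simp [this]
    · rcases hst.eq_or_lt with rfl | hlt
      · exact hleft le_rfl
      · obtain ⟨l, hl⟩ := (ω'.rcll (t - s)).2
        refine ⟨c.glue (ω s) (ω' 0) l, ?_⟩
        have h1 : Tendsto (fun u : ℝ≥0 => u - s) (𝓝[<] t) (𝓝[<] (t - s)) := by
          refine tendsto_nhdsWithin_iff.2 ⟨?_, ?_⟩
          · exact ((continuous_id.sub continuous_const).tendsto t).mono_left nhdsWithin_le_nhds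
          · filter_upwards [self_mem_nhdsWithin,
              mem_nhdsWithin_of_mem_nhds (Ioi_mem_nhds hlt)] with u hu hu'
            exact tsub_lt_tsub_right_of_le (le_of_lt hu') (Set.mem_Iio.1 hu)
        refine (((c.continuous_glue (ω s) (ω' 0)).tendsto l).comp (hl.comp h1)).congr' ?_
        filter_upwards [mem_nhdsWithin_of_mem_nhds (Ioi_mem_nhds hlt)] with u hu
        have : ¬ u < s := not_lt.2 (le_of_lt hu)
        simp [this]

/-- The concatenation `ω *_τ ω'`: it is `ω` before `τ(ω)`, and `X_τ(ω)`, `ω' 0`, `ω' (t - τ(ω))`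
glued together for `t ≥ τ(ω)`. It equals `ω` if `τ(ω) = ∞`. -/
def concat (c : Pasting E) (τ : Path E → ℝ≥0∞) (ω ω' : Path E) : Path E :=
  open Classical in
  ⟨fun t => if (t : ℝ≥0∞) < τ ω then ω t
    else c.glue (posAt τ ω) (ω' 0) (ω' (t - (τ ω).toNNReal)), rcll_concat c (τ ω) ω ω'⟩

section Laws

variable [PolishSpace E] [MeasurableSpace E] [BorelSpace E]

theorem measurable_coord (t : ℝ≥0) : Measurable fun ω : Path E => ω t :=
  (measurable_pi_apply t).comp (comap_measurable _)

theorem measurable_eval : Measurable fun p : Path E × ℝ≥0 => p.1 p.2 := by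
  have hlim : ∀ p : Path E × ℝ≥0,
      Tendsto (fun n : ℕ => p.1 (((⌊p.2 * (n + 1)⌋₊ : ℝ≥0) + 1) / (n + 1))) atTop
        (𝓝 (p.1 p.2)) := by
    rintro ⟨ω, s⟩
    have h1 : ∀ n : ℕ, s ≤ ((⌊s * (n + 1)⌋₊ : ℝ≥0) + 1) / (n + 1) := fun n => by
      rw [le_div_iff₀ (by positivity)]
      exact (Nat.lt_floor_add_one _).le
    have h2 : ∀ n : ℕ, ((⌊s * (n + 1)⌋₊ : ℝ≥0) + 1) / (n + 1) ≤ s + 1 / (n + 1) := fun n => by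
      rw [div_le_iff₀ (by positivity), add_mul, one_div, inv_mul_cancel₀ (by positivity)]
      gcongr
      exact Nat.floor_le (by positivity)
    have h3 : Tendsto (fun n : ℕ => s + 1 / ((n : ℝ≥0) + 1)) atTop (𝓝 s) := by
      simpa using tendsto_const_nhds.add (tendsto_one_div_add_atTop_nhds_zero_nat (𝕜 := ℝ≥0))
    have h4 := tendsto_of_tendsto_of_tendsto_of_le_of_le tendsto_const_nhds h3 h1 h2
    exact (ω.rcll s).1.tendsto.comp
      (tendsto_nhdsWithin_iff.2 ⟨h4, Eventually.of_forall fun n => h1 n⟩)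
  let _ := TopologicalSpace.upgradeIsCompletelyMetrizable E
  refine measurable_of_tendsto_metrizable (fun n => ?_) (tendsto_pi_nhds.2 hlim)
  have h5 : Measurable fun q : Path E × ℕ => q.1 (((q.2 : ℝ≥0) + 1) / (n + 1)) :=
    measurable_from_prod_countable_left fun k => by
      exact measurable_coord (((k : ℝ≥0) + 1) / (n + 1))
  have h6 : Measurable fun p : Path E × ℝ≥0 => (p.1, ⌊p.2 * (n + 1)⌋₊) :=
    measurable_fst.prodMk (Nat.measurable_floor.comp (measurable_snd.mul_const _))
  exact h5.comp h6

theorem measurable_posAt (τ : RandomTime E) : Measurable (posAt τ : Path E → E) :=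
  measurable_eval.comp (measurable_id.prodMk τ.measurable.ennreal_toNNReal)

theorem measurable_concat (c : Pasting E) (τ : RandomTime E) :
    Measurable fun p : Path E × Path E => concat c τ p.1 p.2 := by
  refine measurable_comap_iff.2 (measurable_pi_iff.2 fun t => ?_)
  refine Measurable.ite (measurableSet_lt measurable_const (τ.measurable.comp measurable_fst))
    ((measurable_coord t).comp measurable_fst) ?_
  refine c.continuous_glue_uncurry.measurable.comp
    (((measurable_posAt τ).comp measurable_fst).prodMk
      (((measurable_coord 0).comp measurable_snd).prodMk (measurable_eval.comp
        (measurable_snd.prodMk (measurable_const.sub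
          (τ.measurable.ennreal_toNNReal.comp measurable_fst))))))

/-- The integrands in the definition of the concatenation of laws are measurable up to null
sets. -/
theorem aemeasurable_inner (c : Pasting E) (μ : ProbabilityMeasure (Path E)) (τ : RandomTime E)
    (ν : UKernel E) {A : Set (Path E)} (hA : MeasurableSet A) :
    AEMeasurable (fun ω => (ν (posAt τ ω) : Measure (Path E)) {ω' | concat c τ ω ω' ∈ A})
      (μ : Measure (Path E)) := by
  let κ : ProbabilityTheory.Kernel (NullMeasurableSpace (Path E) (μ : Measure (Path E))) (Path E) :=
    ⟨fun ω => (ν (posAt τ ω) : Measure (Path E)), by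
      refine Measure.measurable_of_measurable_coe _ fun S hS B hB => ?_
      have hp := (measurable_posAt τ).quasiMeasurePreserving (μ : Measure (Path E))
      have : IsProbabilityMeasure ((μ : Measure (Path E)).map (posAt τ)) :=
        Measure.isProbabilityMeasure_map (measurable_posAt τ).aemeasurable
      have hn := NullMeasurableSet.preimage (ν.measurable S hS hB
        ((μ : Measure (Path E)).map (posAt τ))) hp
      exact hn⟩
  have : ProbabilityTheory.IsMarkovKernel κ :=
    ⟨fun ω => inferInstanceAs (IsProbabilityMeasure (ν (posAt τ ω) : Measure (Path E)))⟩
  let j : NullMeasurableSpace (Path E) (μ : Measure (Path E)) → Path E := fun ω => ω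
  have hj : Measurable j := fun s hs => by
    have hn : NullMeasurableSet s (μ : Measure (Path E)) := hs.nullMeasurableSet
    exact hn
  have hS : MeasurableSet {p : NullMeasurableSpace (Path E) (μ : Measure (Path E)) × Path E |
      concat c τ (j p.1) p.2 ∈ A} :=
    ((measurable_concat c τ).comp ((hj.comp measurable_fst).prodMk measurable_snd)) hA
  have hm := ProbabilityTheory.Kernel.measurable_kernel_prodMk_left (κ := κ) hS
  have hn : NullMeasurable
      (fun ω => (ν (posAt τ ω) : Measure (Path E)) {ω' | concat c τ ω ω' ∈ A})
      (μ : Measure (Path E)) := fun B hB => hm hB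
  exact hn.aemeasurable

/-- The concatenation of laws as a measure:
`(μ *_τ ν)[A] = ∫∫ 1_A(ω *_τ ω') ν_{X_τ(ω)}(dω') μ(dω)`. Where `τ(ω) = ∞` the inner integral is
`1_A(ω)`, whichever law is used for `ν_{X_τ(ω)}`. -/
def concatMeasure (c : Pasting E) (μ : ProbabilityMeasure (Path E)) (τ : RandomTime E)
    (ν : UKernel E) : Measure (Path E) :=
  Measure.ofMeasurable
    (fun A _ => ∫⁻ ω, (ν (posAt τ ω) : Measure (Path E)) {ω' | concat c τ ω ω' ∈ A}
      ∂(μ : Measure (Path E)))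
    (by simp)
    (by
      intro f hf hd
      rw [← lintegral_tsum fun i => aemeasurable_inner c μ τ ν (hf i)]
      refine lintegral_congr fun ω => ?_
      rw [← measure_iUnion]
      · congr 1
        ext ω'
        simp
      · intro i j hij
        exact Disjoint.preimage (fun ω' => concat c τ ω ω') (hd hij)
      · intro i
        exact ((measurable_concat c τ).comp measurable_prodMk_left) (hf i))

/-- The concatenation `μ *_τ ν` of laws. -/
def concatLaw (c : Pasting E) (μ : ProbabilityMeasure (Path E)) (τ : RandomTime E)
    (ν : UKernel E) : ProbabilityMeasure (Path E) :=
  ⟨concatMeasure c μ τ ν, ⟨by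
    rw [concatMeasure, Measure.ofMeasurable_apply _ MeasurableSet.univ]
    simp⟩⟩

/-! ### Controlled Markov families and control problems -/

/-- The `P`-selectors: universally measurable kernels with `ν_x ∈ P^x` for all `x`. -/
def selectors (P : E → Set (ProbabilityMeasure (Path E))) : Set (UKernel E) :=
  {ν | ∀ x, ν x ∈ P x}

/-- `(P, T)` is a controlled Markov family. -/
structure IsControlledMarkovFamily (c : Pasting E) (P : E → Set (ProbabilityMeasure (Path E)))
    (T : Set (RandomTime E)) : Prop where
  nonempty : ∀ x, (P x).Nonempty
  analytic : IsAnalytic {p : E × ProbabilityMeasure (Path E) | p.2 ∈ P p.1}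
  concatenable : ∀ x, ∀ μ ∈ P x, ∀ τ ∈ T, ∀ ν ∈ selectors P, concatLaw c μ τ ν ∈ P x

/-- `(P, T, G)` is a Markov control problem. -/
structure IsMarkovControlProblem (c : Pasting E) (P : E → Set (ProbabilityMeasure (Path E)))
    (T : Set (RandomTime E)) (G : Path E → EReal) : Prop where
  family : IsControlledMarkovFamily c P T
  measurable : UniversallyMeasurable G
  lowerSemiIntegrable : ∀ x, ∀ μ ∈ P x, LowerSemiIntegrable μ G

/-- The value function `v(x) = inf_{μ ∈ P^x} E^μ[G]`. -/
def value (P : E → Set (ProbabilityMeasure (Path E))) (G : Path E → EReal) (x : E) : EReal :=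
  ⨅ μ ∈ P x, expect μ G

/-- The random variable `g(X_τ) 1_{τ < ∞} + G 1_{τ = ∞}`. -/
def continuation (τ : RandomTime E) (g : E → EReal) (G : Path E → EReal) (ω : Path E) : EReal :=
  open Classical in
  if τ ω < ∞ then g (posAt τ ω) else G ω

/-- A Borel random variable `G` is a tail random variable if
`E^{μ *_τ ν}[G] = E^μ[g(X_τ) 1_{τ < ∞} + G 1_{τ = ∞}]`, where `g(x) = E^{ν_x}[G]`. -/
structure IsTail (c : Pasting E) (P : E → Set (ProbabilityMeasure (Path E)))
    (T : Set (RandomTime E)) (G : Path E → EReal) : Prop where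
  borel : Measurable G
  lowerSemiIntegrable : ∀ x, ∀ μ ∈ P x, LowerSemiIntegrable μ G
  expect_eq : ∀ x, ∀ μ ∈ P x, ∀ ν ∈ selectors P, ∀ τ ∈ T,
    expect (concatLaw c μ τ ν) G = expect μ (continuation τ (fun y => expect (ν y) G) G)

/-- `G` is approximately disintegrable. -/
structure IsApproxDisintegrable (c : Pasting E) (P : E → Set (ProbabilityMeasure (Path E)))
    (T : Set (RandomTime E)) (G : Path E → EReal) : Prop where
  tail : IsTail c P T G
  disintegrable : ∀ x, ∀ μ ∈ P x, ∀ τ ∈ T, ∀ ε : ℝ, 0 < ε →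
    ∃ ν ∈ selectors P, expect (concatLaw c μ τ ν) G ≤ expect μ G + (ε : EReal)

/-- `a + ε` with the convention `-∞ + ε = -1/ε`. -/
def addEps (a : EReal) (ε : ℝ) : EReal :=
  open Classical in
  if a = ⊥ then ((-1 / ε : ℝ) : EReal) else a + (ε : EReal)

/-- `μ` is `ε`-optimal at `x`: it lies in `P^x` and `E^μ[G] < v(x) + ε`; where `v(x) = ∞`,
every element of `P^x` has `E^μ[G] = ∞ = v(x)` and is regarded as `ε`-optimal. -/
def IsEpsOptimal (P : E → Set (ProbabilityMeasure (Path E))) (G : Path E → EReal) (ε : ℝ) (x : E)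
    (μ : ProbabilityMeasure (Path E)) : Prop :=
  μ ∈ P x ∧ (value P G x = ⊤ ∨ expect μ G < addEps (value P G x) ε)

end Laws

end DPP

end

/-! The value is below `a` at `x` exactly when some law in `P x` has expectation below `a`. Since
`G` is Borel, the expectation is a Borel function of the law, so `{v < a}` is the projection of an
analytic graph cut by a Borel set, hence analytic (`lowerSemianalytic_value`). This requires the
laws to form a standard Borel space, which reduces to the path space being one: a path is coded by
its values on a countable dense set of times, and the codes form a Borel set
(`range_restrict_path`).

Selectors come from the Jankov–von Neumann theorem, with leftmost branches as selections. Their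
measurability rests on the universal measurability of analytic sets
(`universallyMeasurableSet_of_analyticSet`). Selections at rational levels, glued along the first
rational between `v` and `v + ε`, give `ε`-optimal selectors (`exists_epsOptimal_selector`).

For the dynamic programming equation, continuing `μ` after `τ` with an `ε`-optimal selector stays in
`P x`, and the tail property bounds `v(x)` by the expected continuation with `v + ε`. As `ε → 0`,
`le_expect_of_antitone` gives one inequality (`value_le_expect_continuation`). Conversely,
approximate disintegration supplies a selector whose concatenation costs at most `ε` more than `μ`,
and its conditional costs dominate `v` (`iInf_expect_continuation_le_value`). -/

noncomputable section

namespace DPP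

/-! ### The universal `σ`-algebra -/

/-- The universal `σ`-algebra. -/
@[reducible]
def universalSpace (X : Type*) [MeasurableSpace X] : MeasurableSpace X where
  MeasurableSet' := UniversallyMeasurableSet
  measurableSet_empty := fun _ _ => nullMeasurableSet_empty
  measurableSet_compl := fun _ hA μ _ => (hA μ).compl
  measurableSet_iUnion := fun _ hA μ _ => NullMeasurableSet.iUnion fun i => hA i μ

theorem universallyMeasurable_iff {X Y : Type*} [MeasurableSpace X] [MeasurableSpace Y]
    {f : X → Y} : UniversallyMeasurable f ↔ Measurable[universalSpace X] f :=
  Iff.rfl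

/-- The preimage of a universally measurable set under a Borel map is null measurable. -/
theorem UniversallyMeasurable.comp_aemeasurable {X Y : Type*} [MeasurableSpace X]
    [MeasurableSpace Y] {f : X → EReal} (hf : UniversallyMeasurable f) {p : Y → X}
    (hp : Measurable p) (μ : Measure Y) [IsProbabilityMeasure μ] :
    AEMeasurable (fun y => f (p y)) μ := by
  have hn : NullMeasurable (fun y => f (p y)) μ := fun B hB => by
    have : IsProbabilityMeasure (μ.map p) := Measure.isProbabilityMeasure_map hp.aemeasurable
    have h := NullMeasurableSet.preimage (hf hB (μ.map p)) (hp.quasiMeasurePreserving μ)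
    exact h
  exact hn.aemeasurable

/-! ### Analytic sets are universally measurable: inner approximation by compact sets -/

/-- The image of the sequences with the first `n` terms bounded by those of `k` exhausts, for
suitable `k`, most of the measure of the whole image, uniformly in `n`. -/
theorem exists_bounds_lt_measure_image {X : Type*} [MeasurableSpace X] (μ : Measure X)
    (f : (ℕ → ℕ) → X) {r : ℝ≥0∞} (hr : r < μ (Set.range f)) :
    ∃ k : ℕ → ℕ, ∀ n, r < μ (f '' {z | ∀ i < n, z i ≤ k i}) := by
  have step : ∀ (n : ℕ) (k : ℕ → ℕ), r < μ (f '' {z | ∀ i < n, z i ≤ k i}) →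
      ∃ m, r < μ (f '' {z | ∀ i < n + 1, z i ≤ Function.update k n m i}) := by
    intro n k h
    have hU : f '' {z | ∀ i < n, z i ≤ k i} =
        ⋃ m, f '' {z | ∀ i < n + 1, z i ≤ Function.update k n m i} := by
      rw [← Set.image_iUnion]
      congr 1
      ext z
      simp only [Set.mem_ofPred_eq, Set.mem_iUnion]
      constructor
      · intro hz
        refine ⟨z n, fun i hi => ?_⟩
        rcases Nat.lt_succ_iff_lt_or_eq.1 hi with hi | rfl
        · rw [Function.update_of_ne hi.ne]
          exact hz i hi
        · simp
      · rintro ⟨m, hz⟩ i hi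
        have := hz i (hi.trans n.lt_succ_self)
        rwa [Function.update_of_ne hi.ne] at this
    have hmono : Monotone fun m => f '' {z | ∀ i < n + 1, z i ≤ Function.update k n m i} := by
      intro m m' hm
      refine Set.image_mono fun z hz i hi => (hz i hi).trans ?_
      exact Function.update_mono hm i
    -- Continuity from below holds for the outer measure along any increasing sequence, so these
    -- images need not be known to be measurable.
    rw [hU, hmono.measure_iUnion] at h
    exact lt_iSup_iff.1 h
  choose! m hm using step
  let K : ℕ → ℕ → ℕ := fun n => Nat.rec (fun _ => 0) (fun n k => Function.update k n (m n k)) n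
  have hK : ∀ n, K (n + 1) = Function.update (K n) n (m n (K n)) := fun n => rfl
  have h1 : ∀ n, r < μ (f '' {z | ∀ i < n, z i ≤ K n i}) := by
    intro n
    induction n with
    | zero => simpa using hr
    | succ n ih =>
      rw [hK]
      exact hm n (K n) ih
  -- Entry `i` is fixed at stage `i + 1` and never changed again, so the diagonal `K (i + 1) i`
  -- agrees with `K n` below `n`.
  have h2 : ∀ i n, i < n → K n i = K (i + 1) i := by
    intro i n hin
    induction n, hin using Nat.le_induction with
    | base => rfl
    | succ n hn ih =>
      rw [hK, Function.update_of_ne (by omega), ih]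
  refine ⟨fun i => K (i + 1) i, fun n => ?_⟩
  convert h1 n using 6 with z i
  exact forall_congr' fun hi => by rw [h2 i n hi]

theorem isCompact_box (k : ℕ → ℕ) : IsCompact {z : ℕ → ℕ | ∀ i, z i ≤ k i} := by
  convert isCompact_univ_pi fun i => (Set.finite_Iic (k i)).isCompact using 1
  ext z
  simp [Pi.le_def]

/-- An open neighbourhood of the image of a box of sequences contains the image of all sequences
whose first `n` terms obey the bounds, for some `n`. -/
theorem exists_bounded_prefix_subset {X : Type*} [TopologicalSpace X] {f : (ℕ → ℕ) → X}
    (hf : Continuous f) (k : ℕ → ℕ) {U : Set X} (hU : IsOpen U)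
    (hkU : f '' {z | ∀ i, z i ≤ k i} ⊆ U) : ∃ n, f '' {z | ∀ i < n, z i ≤ k i} ⊆ U := by
  by_contra! hcon
  have hex : ∀ n, ∃ z : ℕ → ℕ, (∀ i < n, z i ≤ k i) ∧ f z ∉ U := by
    intro n
    obtain ⟨_, ⟨z, hz, rfl⟩, hzU⟩ := Set.not_subset.1 (hcon n)
    exact ⟨z, hz, hzU⟩
  choose z hz hzU using hex
  -- Truncation by `k` moves the sequences into the compact box. It leaves coordinate `i` of `z n`
  -- unchanged once `n > i`, so the subsequence of `z` itself has the same limit.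
  obtain ⟨w, hw, φ, hφ, hlim⟩ := (isCompact_box k).tendsto_subseq
    (x := fun n i => min (z n i) (k i)) (fun n i => min_le_right _ _)
  have hlim' : Tendsto (fun n => z (φ n)) atTop (𝓝 w) := by
    refine tendsto_pi_nhds.2 fun i => ((tendsto_pi_nhds.1 hlim) i).congr' ?_
    filter_upwards [eventually_gt_atTop i] with n hn
    exact min_eq_left (hz (φ n) i (hn.trans_le (hφ.id_le n)))
  have hev := ((hf.tendsto w).comp hlim').eventually (hU.mem_nhds (hkU ⟨w, hw, rfl⟩))
  obtain ⟨n, hn⟩ := hev.exists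
  exact hzU (φ n) hn

/-- Analytic sets are universally measurable. -/
theorem universallyMeasurableSet_of_analyticSet {X : Type*} [TopologicalSpace X] [PolishSpace X]
    [MeasurableSpace X] [BorelSpace X] {A : Set X} (hA : AnalyticSet A) :
    UniversallyMeasurableSet A := by
  intro μ _
  rw [AnalyticSet] at hA
  rcases hA with rfl | ⟨f, hf, rfl⟩
  · exact nullMeasurableSet_empty
  let _ := TopologicalSpace.upgradeIsCompletelyMetrizable X
  have key : ∀ r < μ (Set.range f), ∃ C ⊆ Set.range f, MeasurableSet C ∧ r ≤ μ C := by
    intro r hr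
    obtain ⟨k, hk⟩ := exists_bounds_lt_measure_image μ f hr
    have hcomp : IsCompact (f '' {z | ∀ i, z i ≤ k i}) := (isCompact_box k).image hf
    refine ⟨_, Set.image_subset_range _ _, hcomp.isClosed.measurableSet, ?_⟩
    -- Otherwise outer regularity gives an open `U` around the compact image with `μ U < r`, yet `U`
    -- contains the image of some prefix-bounded set, which has measure above `r`.
    by_contra! hlt
    obtain ⟨U, hUs, hUo, hUr⟩ := Set.exists_isOpen_lt_of_lt _ _ hlt
    obtain ⟨n, hn⟩ := exists_bounded_prefix_subset hf k hUo hUs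
    exact (hk n).not_ge ((measure_mono hn).trans hUr.le)
  rcases eq_or_ne (μ (Set.range f)) 0 with h0 | h0
  · exact NullMeasurableSet.of_null h0
  obtain ⟨u, -, hu, hulim⟩ := exists_seq_strictMono_tendsto' (pos_iff_ne_zero.2 h0)
  choose C hC hCm hCu using fun n => key (u n) (hu n).2
  have hsub : (⋃ n, C n) ⊆ Set.range f := Set.iUnion_subset hC
  have hle : μ (Set.range f) ≤ μ (⋃ n, C n) :=
    le_of_tendsto' hulim fun n => (hCu n).trans (measure_mono (Set.subset_iUnion C n))
  have hae : (⋃ n, C n) =ᵐ[μ] Set.range f :=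
    ae_eq_of_subset_of_measure_ge hsub hle
      (MeasurableSet.iUnion hCm).nullMeasurableSet (measure_ne_top _ _)
  exact (MeasurableSet.iUnion hCm).nullMeasurableSet.congr hae

/-! ### Measurable selection -/

/-- The least natural number with a measurable property is measurable. -/
theorem measurable_sInf_nat {X : Type*} [MeasurableSpace X] {p : X → ℕ → Prop}
    (hp : ∀ k, MeasurableSet {x | p x k}) : Measurable fun x => sInf {k | p x k} := by
  classical
  -- The second alternative makes the search stop at `0` when no index qualifies, matching `sInf ∅ =
  -- 0`.
  have hm : ∀ k, MeasurableSet {x | p x k ∨ ∀ j, ¬ p x j} := fun k =>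
    (hp k).union (by
      have : {x | ∀ j, ¬ p x j} = ⋂ j, {x | p x j}ᶜ := by ext; simp
      exact this.symm.subst (MeasurableSet.iInter fun j => (hp j).compl))
  have hex : ∀ x, ∃ k, p x k ∨ ∀ j, ¬ p x j := fun x => by
    by_cases h : ∃ k, p x k
    · exact h.imp fun k hk => Or.inl hk
    · exact ⟨0, Or.inr (not_exists.1 h)⟩
  convert measurable_find hex hm using 2 with x
  by_cases h : ∃ k, p x k
  · have : {k | p x k}.Nonempty := h
    rw [Nat.sInf_def this]
    refine (Nat.find_congr' fun {k} => ?_)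
    exact ⟨Or.inl, fun h' => h'.resolve_right fun hn => h.elim hn⟩
  · have : {k | p x k} = ∅ := Set.eq_empty_iff_forall_notMem.2 (not_exists.1 h)
    rw [this, Nat.sInf_empty]
    exact ((Nat.find_eq_zero _).2 (Or.inr (not_exists.1 h))).symm

/-- Finite prefixes of the leftmost element of the fibre of `p` over `x`. -/
def leftmostPrefix {X : Type*} (p : (ℕ → ℕ) → X) (x : X) : ℕ → ℕ → ℕ
  | 0 => fun _ => 0
  | n + 1 => Function.update (leftmostPrefix p x n) n
      (sInf {k | ∃ z, p z = x ∧ (∀ i < n, z i = leftmostPrefix p x n i) ∧ z n = k})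

/-- The leftmost element of the fibre of `p` over `x`. -/
def leftmost {X : Type*} (p : (ℕ → ℕ) → X) (x : X) (n : ℕ) : ℕ := leftmostPrefix p x (n + 1) n

theorem leftmostPrefix_of_lt {X : Type*} (p : (ℕ → ℕ) → X) (x : X) {i n : ℕ} (h : i < n) :
    leftmostPrefix p x n i = leftmost p x i := by
  induction n, h using Nat.le_induction with
  | base => rfl
  | succ n hn ih => rw [leftmostPrefix, Function.update_of_ne (by omega), ih]

/-- Over a nonempty fibre each entry is a minimum of a nonempty set of naturals, hence attained by a
point with the prescribed prefix. That point may vary with `n`. -/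
theorem exists_fiber_eq_leftmost {X : Type*} {p : (ℕ → ℕ) → X} {x : X} (hx : x ∈ Set.range p)
    (n : ℕ) : ∃ z, p z = x ∧ ∀ i < n, z i = leftmost p x i := by
  induction n with
  | zero => exact hx.imp fun z hz => ⟨hz, by simp⟩
  | succ n ih =>
    obtain ⟨z, hz, hzi⟩ := ih
    have hne : {k | ∃ z, p z = x ∧ (∀ i < n, z i = leftmostPrefix p x n i) ∧ z n = k}.Nonempty :=
      ⟨z n, z, hz, fun i hi => by rw [hzi i hi, leftmostPrefix_of_lt p x hi], rfl⟩
    obtain ⟨w, hw, hwi, hwn⟩ := Nat.sInf_mem hne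
    refine ⟨w, hw, fun i hi => ?_⟩
    rcases Nat.lt_succ_iff_lt_or_eq.1 hi with hi | rfl
    · rw [hwi i hi, leftmostPrefix_of_lt p x hi]
    · rw [hwn, leftmost, leftmostPrefix, Function.update_self]

/-- Points of the fibre with ever longer leftmost prefixes converge to `leftmost p x`, and the fibre
of a continuous map is closed. -/
theorem apply_leftmost {X : Type*} [TopologicalSpace X] [T2Space X] {p : (ℕ → ℕ) → X}
    (hp : Continuous p) {x : X} (hx : x ∈ Set.range p) : p (leftmost p x) = x := by
  choose z hz hzi using exists_fiber_eq_leftmost hx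
  have hlim : Tendsto z atTop (𝓝 (leftmost p x)) := by
    refine tendsto_pi_nhds.2 fun i => tendsto_const_nhds.congr' ?_
    filter_upwards [eventually_gt_atTop i] with n hn
    exact (hzi n i hn).symm
  refine tendsto_nhds_unique ((hp.tendsto _).comp hlim) ?_
  exact tendsto_const_nhds.congr fun n => (hz n).symm

/-- There are countably many possible prefixes. With the prefix fixed, the points admitting a given
next entry form the image of a closed cylinder, an analytic and so universally measurable set. -/
theorem measurable_leftmost {X : Type*} [TopologicalSpace X] [PolishSpace X] [MeasurableSpace X]
    [BorelSpace X] {p : (ℕ → ℕ) → X} (hp : Continuous p) :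
    Measurable[universalSpace X] (leftmost p) := by
  have hcyl : ∀ (n : ℕ) (w : Fin n → ℕ) (k : ℕ),
      UniversallyMeasurableSet (p '' {z | (∀ i : Fin n, z i = w i) ∧ z n = k}) := by
    intro n w k
    have hclosed : IsClosed {z : ℕ → ℕ | (∀ i : Fin n, z i = w i) ∧ z n = k} := by
      refine IsClosed.inter (s₁ := {z : ℕ → ℕ | ∀ i : Fin n, z i = w i}) ?_ ?_
      · rw [Set.ofPred_forall]
        exact isClosed_iInter fun i => isClosed_eq (continuous_apply _) continuous_const
      · exact isClosed_eq (continuous_apply _) continuous_const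
    exact universallyMeasurableSet_of_analyticSet
      (hclosed.measurableSet.analyticSet.image_of_continuous hp)
  let mX : MeasurableSpace X := universalSpace X
  have hpre : ∀ n, Measurable[mX] fun x => leftmostPrefix p x n := by
    intro n
    induction n with
    | zero => exact measurable_const
    | succ n ih =>
      have hset : ∀ k, MeasurableSet[mX] {x | ∃ z, p z = x ∧
          (∀ i < n, z i = leftmostPrefix p x n i) ∧ z n = k} := by
        intro k
        have heq : {x | ∃ z, p z = x ∧ (∀ i < n, z i = leftmostPrefix p x n i) ∧ z n = k} =
            ⋃ w : Fin n → ℕ, {x | ∀ i : Fin n, w i = leftmostPrefix p x n i} ∩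
              p '' {z | (∀ i : Fin n, z i = w i) ∧ z n = k} := by
          ext x
          simp only [Set.mem_ofPred_eq, Set.mem_iUnion, Set.mem_inter_iff, Set.mem_image]
          constructor
          · rintro ⟨z, hz, hzi, hzn⟩
            exact ⟨fun i => z i, fun i => hzi i i.2, z, ⟨fun i => rfl, hzn⟩, hz⟩
          · rintro ⟨w, hw, z, ⟨hzi, hzn⟩, hz⟩
            exact ⟨z, hz, fun i hi => (hzi ⟨i, hi⟩).trans (hw ⟨i, hi⟩), hzn⟩
        rw [heq]
        refine MeasurableSet.iUnion fun w => MeasurableSet.inter ?_ ?_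
        · have : {x | ∀ i : Fin n, w i = leftmostPrefix p x n i} =
              ⋂ i : Fin n, {x | leftmostPrefix p x n i = w i} := by
            ext x
            simp [eq_comm]
          rw [this]
          exact MeasurableSet.iInter fun i =>
            ((measurable_pi_apply (i : ℕ)).comp ih) (measurableSet_singleton (w i))
        · exact hcyl n w k
      refine measurable_pi_iff.2 fun i => ?_
      rcases eq_or_ne i n with rfl | hi
      · simpa only [leftmostPrefix, Function.update_self] using @measurable_sInf_nat X mX _ hset
      · simp only [leftmostPrefix, Function.update_of_ne hi]
        exact (measurable_pi_apply i).comp ih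
  exact measurable_pi_iff.2 fun n => (measurable_pi_apply n).comp (hpre (n + 1))

/-- The projection of a Borel set is analytic. -/
theorem analyticSet_image_fst {X Y : Type*} [TopologicalSpace X] [PolishSpace X]
    [MeasurableSpace X] [BorelSpace X] [MeasurableSpace Y] [StandardBorelSpace Y]
    {C : Set (X × Y)} (hC : MeasurableSet C) : AnalyticSet (Prod.fst '' C) := by
  let _ := upgradeStandardBorel Y
  exact hC.analyticSet.image_of_continuous continuous_fst

/-- The selection theorem of Jankov and von Neumann. -/
theorem exists_measurable_selection {X Y : Type*} [TopologicalSpace X] [PolishSpace X]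
    [MeasurableSpace X] [BorelSpace X] [MeasurableSpace Y] [StandardBorelSpace Y] [Nonempty Y]
    {C : Set (X × Y)} (hC : MeasurableSet C) :
    ∃ f : X → Y, Measurable[universalSpace X] f ∧ ∀ x ∈ Prod.fst '' C, (x, f x) ∈ C := by
  let _ := upgradeStandardBorel Y
  have hA := hC.analyticSet
  rw [AnalyticSet] at hA
  rcases hA with rfl | ⟨g, hg, rfl⟩
  · exact ⟨fun _ => Classical.arbitrary Y, measurable_const, by simp⟩
  have hp : Continuous fun z => (g z).1 := continuous_fst.comp hg
  -- With `C` parametrized by `g`, the selection is the second coordinate at the leftmost parameter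
  -- over `x`.
  refine ⟨fun x => (g (leftmost (fun z => (g z).1) x)).2,
    (measurable_snd.comp hg.measurable).comp (measurable_leftmost hp), ?_⟩
  rintro _ ⟨_, ⟨z, rfl⟩, rfl⟩
  have h := apply_leftmost hp (x := (g z).1) ⟨z, rfl⟩
  exact ⟨leftmost (fun z => (g z).1) (g z).1, Prod.ext h rfl⟩

theorem LowerSemianalytic.universallyMeasurable {X : Type*} [TopologicalSpace X] [PolishSpace X]
    [MeasurableSpace X] [BorelSpace X] {f : X → EReal} (hf : LowerSemianalytic f) :
    UniversallyMeasurable f := by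
  have h : ∀ a : ℝ, MeasurableSet[universalSpace X] {x | f x < (a : EReal)} := fun a =>
    universallyMeasurableSet_of_analyticSet ((isAnalytic_iff_analyticSet _).1 (hf a))
  refine universallyMeasurable_iff.2 (@measurable_of_Iio _ _ _ _ _ (universalSpace X) _ _ _ _ ?_)
  intro a
  induction a with
  | bot => simp
  | coe a => exact h a
  | top =>
    have : f ⁻¹' Set.Iio ⊤ = ⋃ n : ℕ, {x | f x < ((n : ℝ) : EReal)} := by
      ext x
      simp only [Set.mem_preimage, Set.mem_Iio, Set.mem_iUnion, Set.mem_ofPred_eq]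
      refine ⟨fun hx => ?_, fun ⟨n, hn⟩ => hn.trans (EReal.coe_lt_top _)⟩
      obtain ⟨r, hr, -⟩ := EReal.lt_iff_exists_real_btwn.1 hx
      obtain ⟨n, hn⟩ := exists_nat_gt r
      exact ⟨n, hr.trans (EReal.coe_lt_coe_iff.2 hn)⟩
    rw [this]
    exact MeasurableSet.iUnion fun n => h n

/-! ### Standard Borel spaces of laws -/

/-- The range is a Borel set and carries a Polish topology generating its `σ`-algebra; this topology
is pulled back along the embedding. -/
theorem _root_.MeasurableEmbedding.standardBorelSpace {X Y : Type*} [MeasurableSpace X]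
    [MeasurableSpace Y] [StandardBorelSpace Y] {f : X → Y} (hf : MeasurableEmbedding f) :
    StandardBorelSpace X := by
  have : StandardBorelSpace (Set.range f) := hf.measurableSet_range.standardBorel
  let _ := upgradeStandardBorel (Set.range f)
  let e : X ≃ᵐ Set.range f := hf.equivRange
  let t : TopologicalSpace X := TopologicalSpace.induced e inferInstance
  have hi : IsInducing e := ⟨rfl⟩
  let h : X ≃ₜ Set.range f := e.toEquiv.toHomeomorphOfIsInducing hi
  have hb : BorelSpace X := ⟨by
    rw [← e.measurableEmbedding.comap_eq, borel_comap]
    exact congrArg _ (eq_borel_upgradeStandardBorel (Set.range f))⟩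
  exact ⟨t, hb, h.isClosedEmbedding.polishSpace⟩

/-- A measurable retract of a standard Borel space is standard Borel. -/
theorem standardBorelSpace_of_leftInverse {X Y : Type*} [MeasurableSpace X]
    [MeasurableSpace Y] [StandardBorelSpace Y] {f : X → Y} {g : Y → X} (hf : Measurable f)
    (hg : Measurable g) (h : Function.LeftInverse g f) : StandardBorelSpace X := by
  -- The range is the set where `f ∘ g` and the identity agree, which is what makes it measurable.
  have hr : Set.range f = {y | f (g y) = y} := by
    ext y
    exact ⟨by rintro ⟨x, rfl⟩; exact congrArg f (h x), fun hy => ⟨g y, hy⟩⟩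
  have hm : MeasurableSet (Set.range f) := hr ▸ measurableSet_eq_fun (hf.comp hg) measurable_id
  exact (MeasurableEmbedding.of_measurable_inverse hf hm hg h).standardBorelSpace

/-- A law on `ℝ` is determined by the values of its distribution function at rationals, through
a measurable procedure. -/
theorem stieltjesOfMeasurableRat_measure_eq (μ : Measure ℝ) [IsProbabilityMeasure μ] :
    (ProbabilityTheory.stieltjesOfMeasurableRat (id : (ℚ → ℝ) → ℚ → ℝ) measurable_id
      fun q => μ.real (Set.Iic (q : ℝ))).measure = μ := by
  have hq : ∀ q : ℚ, μ.real (Set.Iic (q : ℝ)) = ProbabilityTheory.cdf μ q := fun q =>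
    (ProbabilityTheory.cdf_eq_real μ q).symm
  -- Inputs that are not Stieltjes points are replaced by a default function; rational values of a
  -- distribution function are kept.
  have hpt : ProbabilityTheory.IsRatStieltjesPoint (id : (ℚ → ℝ) → ℚ → ℝ)
      fun q => μ.real (Set.Iic (q : ℝ)) := by
    simp only [hq]
    refine ⟨fun q r h => (ProbabilityTheory.cdf μ).mono (by exact_mod_cast h), ?_, ?_, ?_⟩
    · exact (ProbabilityTheory.tendsto_cdf_atTop μ).comp
        (tendsto_ratCast_atTop_iff.2 tendsto_id)
    · exact (ProbabilityTheory.tendsto_cdf_atBot μ).comp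
        (tendsto_ratCast_atBot_iff.2 tendsto_id)
    · intro t
      refine Eq.trans ?_ ((ProbabilityTheory.cdf μ).iInf_rat_gt_eq t)
      refine Equiv.iInf_congr (Equiv.subtypeEquivRight fun r => ?_) fun r => rfl
      simp
  have hrat : ∀ r : ℚ, ProbabilityTheory.stieltjesOfMeasurableRat (id : (ℚ → ℝ) → ℚ → ℝ)
      measurable_id (fun q => μ.real (Set.Iic (q : ℝ))) r = ProbabilityTheory.cdf μ r := fun r => by
    rw [ProbabilityTheory.stieltjesOfMeasurableRat_eq,
      ProbabilityTheory.toRatCDF_of_isRatStieltjesPoint hpt]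
    exact hq r
  refine Measure.ext_of_Iic _ _ fun x => ?_
  rw [ProbabilityTheory.measure_stieltjesOfMeasurableRat_Iic, ← ProbabilityTheory.ofReal_cdf,
    ← StieltjesFunction.iInf_rat_gt_eq, ← StieltjesFunction.iInf_rat_gt_eq]
  simp only [hrat]

/-- Through an embedding `e` of `Ω` in the line, a law is coded by a distribution function at the
rationals. Any `a : ℚ → ℝ` decodes to a law on the line, pushed back by a left inverse `ρ` of `e`,
so the laws are a measurable retract of `ℚ → ℝ`. -/
instance {Ω : Type*} [MeasurableSpace Ω] [StandardBorelSpace Ω] :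
    StandardBorelSpace (ProbabilityMeasure Ω) := by
  rcases isEmpty_or_nonempty Ω with hΩ | hΩ
  · have : IsEmpty (ProbabilityMeasure Ω) := ⟨fun μ => by
      have h := measure_univ (μ := (μ : Measure Ω))
      simp [Set.univ_eq_empty_iff.2 hΩ] at h⟩
    infer_instance
  obtain ⟨e, he⟩ := exists_measurableEmbedding_real Ω
  obtain ⟨ρ, hρ, hρe⟩ := he.exists_measurable_extend measurable_id fun _ => hΩ
  have hae : ∀ μ : ProbabilityMeasure Ω, IsProbabilityMeasure ((μ : Measure Ω).map e) := fun μ =>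
    Measure.isProbabilityMeasure_map he.measurable.aemeasurable
  let S : (ℚ → ℝ) → Measure ℝ := fun a =>
    (ProbabilityTheory.stieltjesOfMeasurableRat (id : (ℚ → ℝ) → ℚ → ℝ) measurable_id a).measure
  have hS : ∀ a, IsProbabilityMeasure ((S a).map ρ) := fun a =>
    Measure.isProbabilityMeasure_map hρ.aemeasurable
  refine standardBorelSpace_of_leftInverse (Y := ℚ → ℝ)
    (f := fun μ q => ((μ : Measure Ω).map e).real (Set.Iic (q : ℝ)))
    (g := fun a => ⟨(S a).map ρ, hS a⟩) ?_ ?_ ?_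
  · refine measurable_pi_iff.2 fun q => ?_
    exact ((Measure.measurable_coe measurableSet_Iic).comp
      ((Measure.measurable_map e he.measurable).comp measurable_subtype_coe)).ennreal_toReal
  · refine Measurable.subtype_mk ?_
    exact (Measure.measurable_map ρ hρ).comp
      (ProbabilityTheory.measurable_measure_stieltjesOfMeasurableRat measurable_id)
  · intro μ
    refine Subtype.ext ?_
    have h := stieltjesOfMeasurableRat_measure_eq ((μ : Measure Ω).map e)
    change (S _).map ρ = (μ : Measure Ω)
    simp only [S]
    rw [h, Measure.map_map hρ he.measurable, hρe, Measure.map_id]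

/-! ### The path space is standard Borel -/

section Oscillation

variable {E : Type*} [MetricSpace E] {S : Set ℝ≥0}

/-- The function `a` on `S` oscillates by at most `ε` on the open interval `(u, v)`. -/
def OscLE (a : S → E) (ε : ℝ) (u v : ℝ≥0∞) : Prop :=
  ∀ r r' : S, u < (r : ℝ≥0) → (r : ℝ≥0) < v → u < (r' : ℝ≥0) → (r' : ℝ≥0) < v →
    dist (a r) (a r') ≤ ε

theorem OscLE.mono {a : S → E} {ε ε' : ℝ} {u u' v v' : ℝ≥0∞} (h : OscLE a ε u v) (hε : ε ≤ ε')
    (hu : u ≤ u') (hv : v' ≤ v) : OscLE a ε' u' v' := fun r r' h1 h2 h3 h4 =>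
  (h r r' (hu.trans_lt h1) (h2.trans_le hv) (hu.trans_lt h3) (h4.trans_le hv)).trans hε

open Classical in
/-- Each of these times is the first one until which the oscillation since the previous one
exceeds `ε`. -/
def oscTime (a : S → E) (ε : ℝ) : ℕ → ℝ≥0∞
  | 0 => 0
  | n + 1 => ⨆ s : S, if OscLE a ε (oscTime a ε n) (s : ℝ≥0) then ((s : ℝ≥0) : ℝ≥0∞) else 0

theorem exists_mem_between (hS : Dense S) {u v : ℝ≥0∞} (h : u < v) :
    ∃ s : S, u < (s : ℝ≥0) ∧ (s : ℝ≥0) < v := by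
  obtain ⟨x, hux, hxv⟩ := ENNReal.lt_iff_exists_nnreal_btwn.1 h
  obtain ⟨y, hxy, hyv⟩ := ENNReal.lt_iff_exists_nnreal_btwn.1 hxv
  obtain ⟨s, hs, hxs, hsy⟩ := hS.exists_between (ENNReal.coe_lt_coe.1 hxy)
  exact ⟨⟨s, hs⟩, hux.trans (ENNReal.coe_lt_coe.2 hxs), (ENNReal.coe_lt_coe.2 hsy).trans hyv⟩

/-- Every point of `S` below `v` is admissible in the supremum, and such points come arbitrarily
close to `v`. -/
theorem OscLE.le_oscTime (hS : Dense S) {a : S → E} {ε : ℝ} {n : ℕ} {v : ℝ≥0∞}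
    (h : OscLE a ε (oscTime a ε n) v) : v ≤ oscTime a ε (n + 1) := by
  refine le_of_forall_lt fun c hc => ?_
  obtain ⟨s, hcs, hsv⟩ := exists_mem_between hS hc
  refine hcs.trans_le (le_iSup_of_le s ?_)
  rw [if_pos (h.mono le_rfl le_rfl hsv.le)]

/-- Two points strictly below the supremum both lie below a single admissible `s`. -/
theorem oscLE_oscTime (a : S → E) (ε : ℝ) (n : ℕ) :
    OscLE a ε (oscTime a ε n) (oscTime a ε (n + 1)) := by
  have key : ∀ r : S, (r : ℝ≥0) < oscTime a ε (n + 1) → ∃ s : S, (r : ℝ≥0) < (s : ℝ≥0) ∧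
      OscLE a ε (oscTime a ε n) (s : ℝ≥0) := by
    intro r hr
    obtain ⟨s, hs⟩ := lt_iSup_iff.1 hr
    split_ifs at hs with h
    · exact ⟨s, ENNReal.coe_lt_coe.1 hs, h⟩
    · simp at hs
  intro r r' h1 h2 h3 h4
  rcases le_total (r : ℝ≥0) r' with hle | hle
  · obtain ⟨s, hs, hosc⟩ := key r' h4
    exact hosc r r' h1 (ENNReal.coe_lt_coe.2 (hle.trans_lt hs)) h3 (ENNReal.coe_lt_coe.2 hs)
  · obtain ⟨s, hs, hosc⟩ := key r h2
    exact hosc r r' h1 (ENNReal.coe_lt_coe.2 hs) h3 (ENNReal.coe_lt_coe.2 (hle.trans_lt hs))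

/-- At every time the oscillation of `a` is arbitrarily small shortly after and shortly before. -/
def HasSmallOsc (a : S → E) : Prop :=
  ∀ t : ℝ≥0, ∀ ε > 0, (∃ v > (t : ℝ≥0∞), OscLE a ε t v) ∧
    (0 < t → ∃ u < (t : ℝ≥0∞), OscLE a ε u t)

/-- This replaces a condition at uncountably many times by countably many, for measurability. If the
times had a finite supremum `t`, small oscillation to the right of `t` would push them past `t` once
`t` is reached, and small oscillation to the left would make them reach it. If they are unbounded,
consecutive ones enclose the required intervals. -/
theorem hasSmallOsc_iff (hS : Dense S) (a : S → E) :
    HasSmallOsc a ↔ ∀ n : ℕ, ⨆ i, oscTime a (1 / ((n : ℝ) + 1)) i = ∞ := by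
  constructor
  · intro h n
    by_contra hne
    set ε : ℝ := 1 / ((n : ℝ) + 1)
    have hε : 0 < ε := by positivity
    lift ⨆ i, oscTime a ε i to ℝ≥0 using hne with t ht
    have hle : ∀ i, oscTime a ε i ≤ t := fun i => (le_iSup (oscTime a ε) i).trans_eq ht.symm
    obtain ⟨⟨v, htv, hv⟩, hleft⟩ := h t ε hε
    by_cases hex : ∃ i, oscTime a ε i = t
    · obtain ⟨i, hi⟩ := hex
      rw [← hi] at hv
      exact ((hv.le_oscTime hS).trans (hle (i + 1))).not_gt htv
    · have hlt : ∀ i, oscTime a ε i < t := fun i => (hle i).lt_of_ne fun h => hex ⟨i, h⟩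
      obtain ⟨u, hut, hu⟩ := hleft (ENNReal.coe_pos.1 (hlt 0))
      obtain ⟨i, hi⟩ := lt_iSup_iff.1 (hut.trans_eq ht)
      exact ((hu.mono le_rfl hi.le le_rfl).le_oscTime hS).not_gt (hlt (i + 1))
  · intro h t ε hε
    obtain ⟨n, hn⟩ := exists_nat_one_div_lt hε
    have hlt : ∃ i, (t : ℝ≥0∞) < oscTime a (1 / ((n : ℝ) + 1)) i :=
      lt_iSup_iff.1 (h n ▸ ENNReal.coe_lt_top)
    constructor
    · classical
      have hmin := fun j => Nat.find_min (m := j) hlt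
      have hspec := Nat.find_spec hlt
      rcases hj : Nat.find hlt with _ | j
      · rw [hj] at hspec
        exact absurd hspec (by simp [oscTime])
      · rw [hj] at hspec hmin
        exact ⟨_, hspec, (oscLE_oscTime a _ j).mono hn.le (not_lt.1 (hmin j j.lt_succ_self)) le_rfl⟩
    · classical
      intro ht
      -- On the left the first time that is at least `t` is used, so that its predecessor is
      -- strictly below `t`.
      have hle : ∃ i, (t : ℝ≥0∞) ≤ oscTime a (1 / ((n : ℝ) + 1)) i := hlt.imp fun _ h => h.le
      have hmin := fun j => Nat.find_min (m := j) hle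
      have hspec := Nat.find_spec hle
      rcases hj : Nat.find hle with _ | j
      · rw [hj] at hspec
        exact absurd hspec (by simpa [oscTime] using ht.ne')
      · rw [hj] at hspec hmin
        exact ⟨_, not_le.1 (hmin j j.lt_succ_self), (oscLE_oscTime a _ j).mono hn.le le_rfl hspec⟩

/-- Continuity from the right at the points of `S`. -/
def IsRightContinuousOn (a : S → E) : Prop :=
  ∀ q : S, ∀ n : ℕ, ∃ s : S, (q : ℝ≥0) < s ∧
    ∀ r : S, (q : ℝ≥0) < r → (r : ℝ≥0) < s → dist (a r) (a q) ≤ 1 / ((n : ℝ) + 1)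

section Measurability

variable [MeasurableSpace E] [BorelSpace E] [SecondCountableTopology E] [Countable S]

theorem measurable_oscTime (ε : ℝ) (n : ℕ) : Measurable fun a : S → E => oscTime a ε n := by
  classical
  induction n with
  | zero => exact measurable_const
  | succ n ih =>
    refine Measurable.iSup fun s => Measurable.ite ?_ measurable_const measurable_const
    simp only [OscLE, Set.ofPred_forall]
    refine MeasurableSet.iInter fun r => MeasurableSet.iInter fun r' => ?_
    have hd : MeasurableSet {a : S → E | dist (a r) (a r') ≤ ε} :=
      measurableSet_le ((measurable_pi_apply r).dist (measurable_pi_apply r')) measurable_const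
    have hlt : ∀ r : S, MeasurableSet {a : S → E | oscTime a ε n < (r : ℝ≥0)} := fun r =>
      measurableSet_lt ih measurable_const
    have himp : ∀ {p q : (S → E) → Prop}, MeasurableSet {a | p a} → MeasurableSet {a | q a} →
        MeasurableSet {a | p a → q a} := fun {p q} hp hq => by
      have : {a | p a → q a} = {a | p a}ᶜ ∪ {a | q a} := by
        ext a
        simp [imp_iff_not_or]
      rw [this]
      exact hp.compl.union hq
    exact himp (hlt r) (himp (.const _) (himp (hlt r') (himp (.const _) hd)))

theorem measurableSet_hasSmallOsc (hS : Dense S) : MeasurableSet {a : S → E | HasSmallOsc a} := by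
  simp only [hasSmallOsc_iff hS, Set.ofPred_forall]
  exact MeasurableSet.iInter fun n =>
    (Measurable.iSup fun i => measurable_oscTime _ i) (measurableSet_singleton ∞)

theorem measurableSet_isRightContinuousOn :
    MeasurableSet {a : S → E | IsRightContinuousOn a} := by
  simp only [IsRightContinuousOn, Set.ofPred_forall, Set.ofPred_exists, Set.ofPred_and]
  refine MeasurableSet.iInter fun q => MeasurableSet.iInter fun n => MeasurableSet.iUnion fun s =>
    (MeasurableSet.const _).inter ?_
  refine MeasurableSet.iInter fun r => MeasurableSet.iInter fun _ => MeasurableSet.iInter fun _ => ?_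
  exact measurableSet_le ((measurable_pi_apply r).dist (measurable_pi_apply q)) measurable_const

end Measurability

/-! ### Extension of functions on a dense set by right limits -/

/-- The points of `S` to the right of `t`, in the limit towards `t`. -/
def rightFilter (S : Set ℝ≥0) (t : ℝ≥0) : Filter S := comap Subtype.val (𝓝[>] t)

instance (t : ℝ≥0) : (rightFilter S t).IsCountablyGenerated :=
  inferInstanceAs (comap Subtype.val (𝓝[>] t)).IsCountablyGenerated

theorem eventually_rightFilter {t : ℝ≥0} {v : ℝ≥0∞} (h : t < v) :
    ∀ᶠ r : S in rightFilter S t, t < (r : ℝ≥0) ∧ ((r : ℝ≥0) : ℝ≥0∞) < v := by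
  have hopen : IsOpen {x : ℝ≥0 | (x : ℝ≥0∞) < v} :=
    isOpen_lt ENNReal.continuous_coe continuous_const
  refine tendsto_comap.eventually (p := fun x : ℝ≥0 => t < x ∧ (x : ℝ≥0∞) < v) ?_
  exact inter_mem self_mem_nhdsWithin (mem_nhdsWithin_of_mem_nhds (hopen.mem_nhds h))

theorem rightFilter_neBot (hS : Dense S) (t : ℝ≥0) : (rightFilter S t).NeBot := by
  refine comap_neBot fun U hU => ?_
  obtain ⟨v, hv, hvU⟩ := mem_nhdsGT_iff_exists_Ioo_subset.1 hU
  obtain ⟨s, hs, hts⟩ := hS.exists_between hv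
  exact ⟨⟨s, hs⟩, hvU hts⟩

theorem tendsto_rightFilter (ω : Path E) (t : ℝ≥0) :
    Tendsto (fun r : S => ω r) (rightFilter S t) (𝓝 (ω t)) :=
  ((ω.rcll t).1.tendsto.mono_left (nhdsWithin_mono t Set.Ioi_subset_Ici_self)).comp tendsto_comap

/-- Small oscillation to the right of `t` is the Cauchy condition along `rightFilter S t`. -/
theorem exists_tendsto_rightFilter [CompleteSpace E] (hS : Dense S) {a : S → E}
    (ha : HasSmallOsc a) (t : ℝ≥0) : ∃ l, Tendsto a (rightFilter S t) (𝓝 l) := by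
  have := rightFilter_neBot hS t
  refine cauchy_map_iff_exists_tendsto.1 (Metric.cauchy_iff.2 ⟨inferInstance, fun ε hε => ?_⟩)
  obtain ⟨v, htv, hv⟩ := (ha t (ε / 2) (half_pos hε)).1
  refine ⟨_, image_mem_map (eventually_rightFilter htv), ?_⟩
  rintro _ ⟨r, ⟨hr, hrv⟩, rfl⟩ _ ⟨r', ⟨hr', hrv'⟩, rfl⟩
  exact (hv r r' (ENNReal.coe_lt_coe.2 hr) hrv (ENNReal.coe_lt_coe.2 hr') hrv').trans_lt
    (half_lt_self hε)

/-- The bound passes to right limits. The endpoint `u` is allowed because right limits only see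
points strictly to the right. -/
theorem dist_le_of_oscLE (hS : Dense S) {a : S → E} {L : ℝ≥0 → E}
    (hL : ∀ t, Tendsto a (rightFilter S t) (𝓝 (L t))) {ε : ℝ} {u v : ℝ≥0∞} (h : OscLE a ε u v)
    {t t' : ℝ≥0} (hut : u ≤ t) (htv : t < v) (hut' : u ≤ t') (htv' : t' < v) :
    dist (L t) (L t') ≤ ε := by
  have h1 := rightFilter_neBot hS t
  have h2 := rightFilter_neBot hS t'
  refine le_of_tendsto ((hL t).dist tendsto_const_nhds) ?_
  filter_upwards [eventually_rightFilter htv] with r hr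
  refine le_of_tendsto (tendsto_const_nhds.dist (hL t')) ?_
  filter_upwards [eventually_rightFilter htv'] with r' hr'
  exact h r r' (hut.trans_lt (ENNReal.coe_lt_coe.2 hr.1)) hr.2
    (hut'.trans_lt (ENNReal.coe_lt_coe.2 hr'.1)) hr'.2

/-- The functions on a dense set that extend to paths. -/
theorem range_restrict_path [CompleteSpace E] (hS : Dense S) :
    Set.range (fun (ω : Path E) (r : S) => ω r) =
      {a : S → E | HasSmallOsc a} ∩ {a | IsRightContinuousOn a} := by
  ext a
  constructor
  · rintro ⟨ω, rfl⟩
    have hright : ∀ t : ℝ≥0, ∀ ε > 0, ∃ v > t, ∀ r, t ≤ r → r < v → dist (ω r) (ω t) < ε := by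
      intro t ε hε
      obtain ⟨v, hv, hsub⟩ := mem_nhdsGE_iff_exists_Ico_subset.1
        ((ω.rcll t).1.tendsto.eventually (Metric.ball_mem_nhds _ hε))
      exact ⟨v, hv, fun r h1 h2 => hsub ⟨h1, h2⟩⟩
    refine ⟨fun t ε hε => ⟨?_, fun ht => ?_⟩, fun q n => ?_⟩
    · obtain ⟨v, hv, h⟩ := hright t (ε / 2) (half_pos hε)
      refine ⟨v, ENNReal.coe_lt_coe.2 hv, fun r r' h1 h2 h3 h4 => ?_⟩
      have h5 := h r (ENNReal.coe_lt_coe.1 h1).le (ENNReal.coe_lt_coe.1 h2)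
      have h6 := h r' (ENNReal.coe_lt_coe.1 h3).le (ENNReal.coe_lt_coe.1 h4)
      linarith [dist_triangle_right (ω r) (ω r') (ω t)]
    · obtain ⟨l, hl⟩ := (ω.rcll t).2
      obtain ⟨u, hu, hsub⟩ := (mem_nhdsLT_iff_exists_Ioo_subset' ht).1
        (hl.eventually (Metric.ball_mem_nhds _ (half_pos hε)))
      refine ⟨u, ENNReal.coe_lt_coe.2 hu, fun r r' h1 h2 h3 h4 => ?_⟩
      have h5 : dist (ω r) l < ε / 2 := hsub ⟨ENNReal.coe_lt_coe.1 h1, ENNReal.coe_lt_coe.1 h2⟩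
      have h6 : dist (ω r') l < ε / 2 := hsub ⟨ENNReal.coe_lt_coe.1 h3, ENNReal.coe_lt_coe.1 h4⟩
      linarith [dist_triangle_right (ω r) (ω r') l]
    · obtain ⟨v, hv, h⟩ := hright q (1 / ((n : ℝ) + 1)) (by positivity)
      obtain ⟨s, hs, hqs, hsv⟩ := hS.exists_between hv
      exact ⟨⟨s, hs⟩, hqs, fun r h1 h2 => (h r h1.le (h2.trans hsv)).le⟩
  · rintro ⟨ha, hr⟩
    -- The path is the function of right limits. Oscillation bounds give its regularity; right
    -- continuity on `S` is needed only for it to agree with `a` there.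
    choose L hL using exists_tendsto_rightFilter hS ha
    refine ⟨⟨L, fun t => ⟨?_, ?_⟩⟩, funext fun q => ?_⟩
    · refine Metric.tendsto_nhds.2 fun ε hε => ?_
      obtain ⟨v, htv, hv⟩ := (ha t (ε / 2) (half_pos hε)).1
      have hopen : IsOpen {x : ℝ≥0 | (x : ℝ≥0∞) < v} :=
        isOpen_lt ENNReal.continuous_coe continuous_const
      filter_upwards [self_mem_nhdsWithin, mem_nhdsWithin_of_mem_nhds (hopen.mem_nhds htv)]
        with x hx hxv
      exact (dist_le_of_oscLE hS hL hv (ENNReal.coe_le_coe.2 hx) hxv le_rfl htv).trans_lt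
        (half_lt_self hε)
    · rcases eq_or_ne t 0 with rfl | ht
      -- There are no times before `0`, so any point is a left limit.
      · exact ⟨L 0, by simp⟩
      have ht : 0 < t := pos_iff_ne_zero.2 ht
      have := nhdsLT_neBot_of_exists_lt ⟨0, ht⟩
      refine cauchy_map_iff_exists_tendsto.1 (Metric.cauchy_iff.2 ⟨inferInstance, fun ε hε => ?_⟩)
      obtain ⟨u, hut, hu⟩ := (ha t (ε / 2) (half_pos hε)).2 ht
      have hopen : IsOpen {x : ℝ≥0 | u < (x : ℝ≥0∞)} :=
        isOpen_lt continuous_const ENNReal.continuous_coe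
      refine ⟨_, image_mem_map (inter_mem self_mem_nhdsWithin
        (mem_nhdsWithin_of_mem_nhds (hopen.mem_nhds hut))), ?_⟩
      rintro _ ⟨x, ⟨hx, hxu⟩, rfl⟩ _ ⟨y, ⟨hy, hyu⟩, rfl⟩
      exact (dist_le_of_oscLE hS hL hu (le_of_lt hxu) (ENNReal.coe_lt_coe.2 hx) (le_of_lt hyu)
        (ENNReal.coe_lt_coe.2 hy)).trans_lt (half_lt_self hε)
    · have := rightFilter_neBot hS (q : ℝ≥0)
      refine eq_of_forall_dist_le fun ε hε => ?_
      obtain ⟨n, hn⟩ := exists_nat_one_div_lt hε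
      obtain ⟨s, hqs, hs⟩ := hr q n
      refine le_of_tendsto ((hL q).dist tendsto_const_nhds) ?_
      filter_upwards [eventually_rightFilter (ENNReal.coe_lt_coe.2 hqs)] with r hr
      exact (hs r hr.1 (ENNReal.coe_lt_coe.1 hr.2)).trans hn.le

end Oscillation

/-- Restriction to a countable dense set of times is injective by right continuity, generates the
`σ`-algebra because every coordinate is a limit of those in `S`, and has Borel range. -/
instance {E : Type*} [TopologicalSpace E] [PolishSpace E] [MeasurableSpace E] [BorelSpace E] :
    StandardBorelSpace (Path E) := by
  let _ := TopologicalSpace.upgradeIsCompletelyMetrizable E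
  obtain ⟨S, hSc, hS⟩ := TopologicalSpace.exists_countable_dense ℝ≥0
  have := hSc.to_subtype
  let e : Path E → S → E := fun ω r => ω r
  have he : Measurable e := measurable_pi_iff.2 fun r => measurable_coord (E := E) r
  refine MeasurableEmbedding.standardBorelSpace (f := e)
    (MeasurableEmbedding.iff_comap_eq.2 ⟨fun ω ω' h => ?_, le_antisymm ?_ ?_, ?_⟩)
  · have hext : ω.toFun = ω'.toFun := funext fun t => by
      have := rightFilter_neBot hS t
      have h1 := tendsto_rightFilter (S := S) ω t
      rw [show (fun r : S => ω r) = fun r : S => ω' r from h] at h1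
      exact tendsto_nhds_unique h1 (tendsto_rightFilter ω' t)
    cases ω
    cases ω'
    cases hext
    rfl
  · exact he.comap_le
  · refine Measurable.comap_le ((@measurable_pi_iff _ _ _ (MeasurableSpace.comap e inferInstance)
      _ _).2 fun t => ?_)
    have := rightFilter_neBot hS t
    refine @measurable_of_tendsto_metrizable' _ _ (MeasurableSpace.comap e inferInstance) _ _ _ _ _
      (fun (r : S) (ω : Path E) => ω r) (fun ω => ω t) (rightFilter S t) _ _ (fun r => ?_) ?_
    · exact (measurable_pi_apply r).comp (comap_measurable e)
    · exact tendsto_pi_nhds.2 fun ω => tendsto_rightFilter ω t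
  · exact range_restrict_path (E := E) hS ▸
      (measurableSet_hasSmallOsc hS).inter measurableSet_isRightContinuousOn

/-! ### Expectations -/

section Expectation

variable {Ω : Type*} [MeasurableSpace Ω]

/-- No integrability is needed: `∞` for the smaller positive part forces `∞` for the larger, and
then both expectations are `⊤`. -/
theorem expect_mono {μ : ProbabilityMeasure Ω} {Y Z : Ω → EReal} (h : ∀ ω, Y ω ≤ Z ω) :
    expect μ Y ≤ expect μ Z := by
  have h1 : ∫⁻ ω, (Y ω).toENNReal ∂(μ : Measure Ω) ≤ ∫⁻ ω, (Z ω).toENNReal ∂(μ : Measure Ω) :=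
    lintegral_mono fun ω => EReal.toENNReal_le_toENNReal (h ω)
  have h2 : ∫⁻ ω, (-Z ω).toENNReal ∂(μ : Measure Ω) ≤ ∫⁻ ω, (-Y ω).toENNReal ∂(μ : Measure Ω) :=
    lintegral_mono fun ω => EReal.toENNReal_le_toENNReal (EReal.neg_le_neg_iff.2 (h ω))
  rw [expect, expect]
  split_ifs with hY hZ hZ
  · exact le_rfl
  · exact absurd (top_le_iff.1 (hY ▸ h1)) hZ
  · exact le_top
  · exact EReal.sub_le_sub (EReal.coe_ennreal_le_coe_ennreal_iff.2 h1)
      (EReal.coe_ennreal_le_coe_ennreal_iff.2 h2)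

theorem measurable_expect {G : Ω → EReal} (hG : Measurable G) :
    Measurable fun μ : ProbabilityMeasure Ω => expect μ G := by
  have h : ∀ {f : Ω → ℝ≥0∞}, Measurable f →
      Measurable fun μ : ProbabilityMeasure Ω => ∫⁻ ω, f ω ∂(μ : Measure Ω) := fun hf =>
    (Measure.measurable_lintegral hf).comp measurable_subtype_coe
  have h1 := h hG.ereal_toENNReal
  have h2 := h hG.neg.ereal_toENNReal
  exact Measurable.ite (h1 (measurableSet_singleton ∞)) measurable_const
    (h1.coe_ereal_ennreal.sub h2.coe_ereal_ennreal)

/-- A form of the monotone convergence theorem for decreasing sequences that allows the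
expectation `-∞`. -/
theorem le_expect_of_antitone {μ : ProbabilityMeasure Ω} {Y : Ω → EReal} {Z : ℕ → Ω → EReal}
    (hZ : ∀ n, AEMeasurable (Z n) (μ : Measure Ω)) (hanti : ∀ ω, Antitone fun n => Z n ω)
    (hlim : ∀ ω, Tendsto (fun n => Z n ω) atTop (𝓝 (Y ω)))
    {δ : ℕ → ℝ≥0} (hδ : Tendsto δ atTop (𝓝 0))
    (hpos : ∀ n ω, (Z n ω).toENNReal ≤ (Y ω).toENNReal + δ n) {c : EReal}
    (hc : ∀ n, c ≤ expect μ (Z n)) : c ≤ expect μ Y := by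
  rw [expect]
  split_ifs with hY
  · exact le_top
  set A := ∫⁻ ω, (Y ω).toENNReal ∂(μ : Measure Ω)
  -- The positive parts stay within `δ n` of a finite integral, while the negative parts increase,
  -- so monotone convergence applies to them even with limit `∞`.
  have hA : ∀ n, ∫⁻ ω, (Z n ω).toENNReal ∂(μ : Measure Ω) ≤ A + δ n := fun n => by
    refine (lintegral_mono (hpos n)).trans ?_
    rw [lintegral_add_right _ measurable_const]
    simp [A]
  have hB := lintegral_tendsto_of_tendsto_of_monotone (μ := (μ : Measure Ω))
    (f := fun n ω => (-(Z n ω)).toENNReal) (F := fun ω => (-(Y ω)).toENNReal)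
    (fun n => (hZ n).neg.ereal_toENNReal)
    (.of_forall fun ω n m hnm => EReal.toENNReal_le_toENNReal
      (EReal.neg_le_neg_iff.2 (hanti ω hnm)))
    (.of_forall fun ω => (EReal.continuous_toENNReal.tendsto _).comp
      ((continuous_neg.tendsto _).comp (hlim ω)))
  have hA' : Tendsto (fun n => ((A + δ n : ℝ≥0∞) : EReal)) atTop (𝓝 (A : EReal)) := by
    refine (continuous_coe_ennreal_ereal.tendsto _).comp ?_
    simpa using (tendsto_const_nhds (x := A)).add (ENNReal.tendsto_coe.2 hδ)
  -- Addition is continuous at this pair because `A` is finite; the other entry may be `-∞`.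
  have hsub := (EReal.continuousAt_add (p := ((A : EReal), -((∫⁻ ω, (-(Y ω)).toENNReal
    ∂(μ : Measure Ω) : ℝ≥0∞) : EReal))) (.inl (by simpa using hY))
    (.inl (EReal.coe_ennreal_ne_bot _))).tendsto.comp (hA'.prodMk_nhds
      ((continuous_neg.tendsto _).comp ((continuous_coe_ennreal_ereal.tendsto _).comp hB)))
  refine ge_of_tendsto' hsub fun n => (hc n).trans ?_
  rw [expect, if_neg (ne_top_of_le_ne_top (by simpa using hY) (hA n))]
  exact EReal.sub_le_sub (EReal.coe_ennreal_le_coe_ennreal_iff.2 (hA n)) le_rfl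

end Expectation

/-! ### Arithmetic of the convention `-∞ + ε = -1/ε` -/

theorem lt_addEps {a : EReal} (ha : a ≠ ⊤) {ε : ℝ} (hε : 0 < ε) : a < addEps a ε := by
  rw [addEps]
  induction a with
  | bot => simp
  | coe a =>
    rw [if_neg (EReal.coe_ne_bot a), ← EReal.coe_add]
    exact EReal.coe_lt_coe_iff.2 (by linarith)
  | top => exact absurd rfl ha

theorem addEps_top (ε : ℝ) : addEps ⊤ ε = ⊤ := by simp [addEps]

theorem addEps_mono (a : EReal) {ε ε' : ℝ} (hε : 0 < ε) (h : ε ≤ ε') :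
    addEps a ε ≤ addEps a ε' := by
  rw [addEps, addEps]
  split_ifs with ha
  · refine EReal.coe_le_coe_iff.2 ?_
    rw [neg_div, neg_div]
    exact neg_le_neg (one_div_le_one_div_of_le hε h)
  · gcongr

theorem measurable_addEps (ε : ℝ) : Measurable fun a => addEps a ε :=
  Measurable.ite (measurableSet_singleton ⊥) measurable_const (measurable_id.add measurable_const)

/-- This is the domination required by `le_expect_of_antitone`. At `-∞` the new value `-1/δ` is
nonpositive and contributes nothing. -/
theorem toENNReal_addEps_le (a : EReal) (δ : ℝ≥0) :
    (addEps a δ).toENNReal ≤ a.toENNReal + δ := by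
  rw [addEps]
  split_ifs with ha
  · rw [EReal.toENNReal_of_nonpos]
    · exact zero_le
    · exact_mod_cast div_nonpos_of_nonpos_of_nonneg (by norm_num) δ.coe_nonneg
  · refine EReal.toENNReal_add_le.trans_eq ?_
    simp

theorem tendsto_addEps (a : EReal) :
    Tendsto (fun n : ℕ => addEps a (1 / ((n : ℝ) + 1))) atTop (𝓝 a) := by
  by_cases ha : a = ⊥
  · simp only [addEps, ha, if_true, EReal.tendsto_nhds_bot_iff_real]
    intro x
    obtain ⟨m, hm⟩ := exists_nat_gt (-x)
    filter_upwards [eventually_ge_atTop m] with n hn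
    refine EReal.coe_lt_coe_iff.2 ?_
    have : (m : ℝ) ≤ n := by exact_mod_cast hn
    rw [neg_div, one_div_one_div]
    linarith
  · simp only [addEps, ha, if_false]
    have h := (EReal.continuousAt_add (p := (a, ((0 : ℝ) : EReal))) (.inr (EReal.coe_ne_bot _))
      (.inr (EReal.coe_ne_top _))).tendsto.comp ((tendsto_const_nhds (x := a)).prodMk_nhds
        ((continuous_coe_real_ereal.tendsto _).comp tendsto_one_div_add_atTop_nhds_zero_nat))
    simpa [Function.comp_def] using h

/-! ### Selectors -/

section Selection

variable {X Y : Type*} [TopologicalSpace X] [PolishSpace X] [MeasurableSpace X] [BorelSpace X]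
  [MeasurableSpace Y] [StandardBorelSpace Y] {A : Set (X × Y)} {D : Set Y}

/-- The points over which an analytic set meets a Borel set form an analytic set, over which
there is a universally measurable selection. -/
theorem IsAnalytic.exists_selection (hA : IsAnalytic A) (hD : MeasurableSet D) :
    IsAnalytic {x | ∃ y ∈ D, (x, y) ∈ A} ∧ (Nonempty Y → ∃ f : X → Y,
      Measurable[universalSpace X] f ∧ ∀ x, (∃ y ∈ D, (x, y) ∈ A) → f x ∈ D ∧ (x, f x) ∈ A) := by
  obtain ⟨B, hB, rfl⟩ := hA
  -- The real coordinate witnessing analyticity is selected along with `y` and then forgotten.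
  let C : Set (X × Y × ℝ) := {q | ((q.1, q.2.1), q.2.2) ∈ B ∧ q.2.1 ∈ D}
  have hC : MeasurableSet C :=
    (((measurable_fst.prodMk measurable_snd.fst).prodMk measurable_snd.snd) hB).inter
      (measurable_snd.fst hD)
  have hproj : {x | ∃ y ∈ D, (x, y) ∈ Prod.fst '' B} = Prod.fst '' C := by
    ext x
    constructor
    · rintro ⟨y, hy, ⟨⟨_, r⟩, hr, rfl⟩⟩
      exact ⟨(x, y, r), ⟨hr, hy⟩, rfl⟩
    · rintro ⟨⟨x, y, r⟩, ⟨hr, hy⟩, rfl⟩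
      exact ⟨y, hy, ((x, y), r), hr, rfl⟩
  refine ⟨?_, fun hY => ?_⟩
  · rw [hproj, isAnalytic_iff_analyticSet]
    exact analyticSet_image_fst hC
  · obtain ⟨f, hf, hfC⟩ := exists_measurable_selection hC
    refine ⟨fun x => (f x).1, measurable_fst.comp hf, fun x hx => ?_⟩
    obtain ⟨h1, h2⟩ := hfC x (hproj ▸ hx)
    exact ⟨h2, ((x, (f x).1), (f x).2), h1, rfl⟩

end Selection

variable {E : Type*} [TopologicalSpace E] [PolishSpace E] [MeasurableSpace E] [BorelSpace E]
  {c : Pasting E} {P : E → Set (ProbabilityMeasure (Path E))} {T : Set (RandomTime E)}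
  {G : Path E → EReal}

/-- A universally measurable map into the laws is a kernel. -/
def UKernel.ofMeasurable (f : E → ProbabilityMeasure (Path E))
    (hf : Measurable[universalSpace E] f) : UKernel E :=
  ⟨f, fun _ hA => universallyMeasurable_iff.2
    (((Measure.measurable_coe hA).comp measurable_subtype_coe).comp hf)⟩

/-- With a strict inequality it does not matter whether the infimum is attained, so strict sub-level
sets are exact projections. -/
theorem value_lt_iff {x : E} {a : EReal} :
    value P G x < a ↔ ∃ μ ∈ {μ | expect μ G < a}, (x, μ) ∈ {p : E × ProbabilityMeasure (Path E) |
      p.2 ∈ P p.1} := by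
  simp only [value, iInf_lt_iff, exists_prop, Set.mem_ofPred_eq]
  exact exists_congr fun μ => and_comm

theorem lowerSemianalytic_value
    (hP : IsAnalytic {p : E × ProbabilityMeasure (Path E) | p.2 ∈ P p.1}) (hG : Measurable G) :
    LowerSemianalytic (value P G) := fun a => by
  simp only [value_lt_iff]
  exact (hP.exists_selection (measurable_expect hG measurableSet_Iio)).1

theorem exists_epsOptimal_selector (hne : ∀ x, (P x).Nonempty)
    (hP : IsAnalytic {p : E × ProbabilityMeasure (Path E) | p.2 ∈ P p.1}) (hG : Measurable G)
    {ε : ℝ} (hε : 0 < ε) : ∃ ν ∈ selectors P, ∀ x, IsEpsOptimal P G ε x (ν x) := by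
  classical
  rcases isEmpty_or_nonempty E with hE | ⟨⟨x₀⟩⟩
  · exact ⟨UKernel.ofMeasurable isEmptyElim (@measurable_of_empty _ _ (universalSpace E) _ _ _),
      isEmptyElim, isEmptyElim⟩
  have hN : Nonempty (ProbabilityMeasure (Path E)) := (hne x₀).to_type
  have hv : Measurable[universalSpace E] (value P G) :=
    (lowerSemianalytic_value hP hG).universallyMeasurable
  obtain ⟨f, hf, hfP⟩ := (hP.exists_selection MeasurableSet.univ).2 hN
  -- `g a` picks a law of expectation below `a` wherever one exists; `f` serves the points of value
  -- `∞`.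
  choose g hg hgP using fun a : EReal =>
    (hP.exists_selection (measurable_expect hG (measurableSet_Iio (a := a)))).2 hN
  obtain ⟨q, hq⟩ := exists_surjective_nat ℚ
  -- A rational level `q` with `v < q ≤ v + ε` makes any law of expectation below `q` an `ε`-optimal
  -- one. The first such level in the enumeration depends measurably on `v`; points of value `∞`
  -- accept every index.
  let p : ℕ → E → Prop := fun n x => value P G x = ⊤ ∨
    (value P G x < ((q n : ℝ) : EReal) ∧ ((q n : ℝ) : EReal) ≤ addEps (value P G x) ε)
  have hpm : ∀ n, MeasurableSet[universalSpace E] {x | p n x} := fun n => by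
    have hS : MeasurableSet {a : EReal | a = ⊤ ∨ (a < ((q n : ℝ) : EReal) ∧
        ((q n : ℝ) : EReal) ≤ addEps a ε)} :=
      (measurableSet_singleton ⊤).union (measurableSet_Iio.inter
        (measurableSet_le measurable_const (measurable_addEps ε)))
    exact hv hS
  have hpex : ∀ x, ∃ n, p n x := fun x => by
    by_cases hx : value P G x = ⊤
    · exact ⟨0, Or.inl hx⟩
    · obtain ⟨r, hr1, hr2⟩ := EReal.lt_iff_exists_rat_btwn.1 (lt_addEps hx hε)
      obtain ⟨n, rfl⟩ := hq r
      exact ⟨n, Or.inr ⟨hr1, hr2.le⟩⟩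
  have hm := @Measurable.find _ _ _ (universalSpace E)
    (fun n x => if value P G x = ⊤ then f x else g ((q n : ℝ) : EReal) x) p _
    (fun n => Measurable.ite (hv (measurableSet_singleton ⊤)) hf (hg _)) hpm hpex
  have hopt : ∀ x, IsEpsOptimal P G ε x (if value P G x = ⊤ then f x else
      g ((q (Nat.find (hpex x)) : ℝ) : EReal) x) := by
    intro x
    split_ifs with hx
    · obtain ⟨μ, hμ⟩ := hne x
      exact ⟨(hfP x ⟨μ, trivial, hμ⟩).2, Or.inl hx⟩
    · obtain ⟨h1, h2⟩ := (Nat.find_spec (hpex x)).resolve_left hx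
      obtain ⟨h3, h4⟩ := hgP _ x (value_lt_iff.1 h1)
      exact ⟨h4, Or.inr (lt_of_lt_of_le h3 h2)⟩
  exact ⟨UKernel.ofMeasurable _ hm, fun x => (hopt x).1, hopt⟩

/-! ### The dynamic programming principle -/

theorem continuation_mono {τ : RandomTime E} {g h : E → EReal} (hgh : ∀ y, g y ≤ h y)
    (G : Path E → EReal) (ω : Path E) : continuation τ g G ω ≤ continuation τ h G ω := by
  rw [continuation, continuation]
  split_ifs
  · exact hgh _
  · exact le_rfl

theorem aemeasurable_continuation {g : E → EReal} (hg : UniversallyMeasurable g)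
    (hG : Measurable G) (τ : RandomTime E) (μ : ProbabilityMeasure (Path E)) :
    AEMeasurable (continuation τ g G) (μ : Measure (Path E)) := by
  classical
  obtain ⟨f, hf, hae⟩ := hg.comp_aemeasurable (measurable_posAt τ) (μ : Measure (Path E))
  refine ⟨fun ω => if τ ω < ∞ then f ω else G ω,
    Measurable.ite (measurableSet_lt τ.measurable measurable_const) hf hG, ?_⟩
  filter_upwards [hae] with ω hω
  simp only [continuation, hω]

theorem IsEpsOptimal.expect_le {ε : ℝ} {x : E} {μ : ProbabilityMeasure (Path E)}
    (h : IsEpsOptimal P G ε x μ) : expect μ G ≤ addEps (value P G x) ε := by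
  rcases h.2 with h | h
  · rw [h, addEps_top]
    exact le_top
  · exact h.le

/-- A `1 / (n + 1)`-optimal continuation is admissible, which bounds the value by the expectation
with `v` raised by `1 / (n + 1)`. These random variables decrease to the one with `v`. -/
theorem value_le_expect_continuation (hfam : IsControlledMarkovFamily c P T)
    (htail : IsTail c P T G) {τ : RandomTime E} (hτ : τ ∈ T) {x : E}
    {μ : ProbabilityMeasure (Path E)} (hμ : μ ∈ P x) :
    value P G x ≤ expect μ (continuation τ (value P G) G) := by
  have hv := (lowerSemianalytic_value hfam.analytic htail.borel).universallyMeasurable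
  let δ : ℕ → ℝ≥0 := fun n => 1 / ((n : ℝ≥0) + 1)
  have hδ : ∀ n, (δ n : ℝ) = 1 / ((n : ℝ) + 1) := fun n => by simp [δ]
  have hδpos : ∀ n, 0 < (δ n : ℝ) := fun n => by rw [hδ]; positivity
  have hδanti : ∀ {n m : ℕ}, n ≤ m → (δ m : ℝ) ≤ δ n := fun {n m} h => by
    rw [hδ, hδ]
    exact one_div_le_one_div_of_le (by positivity) (by gcongr)
  refine le_expect_of_antitone
    (Z := fun n => continuation τ (fun y => addEps (value P G y) (δ n)) G) (fun n => ?_)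
    (fun ω n m hnm => ?_) (fun ω => ?_) (tendsto_one_div_add_atTop_nhds_zero_nat (𝕜 := ℝ≥0))
    (fun n ω => ?_) (fun n => ?_)
  · exact aemeasurable_continuation
      (universallyMeasurable_iff.2 ((measurable_addEps _).comp (universallyMeasurable_iff.1 hv)))
      htail.borel τ μ
  · exact continuation_mono (fun y => addEps_mono _ (hδpos m) (hδanti hnm)) G ω
  · simp only [continuation, hδ]
    split_ifs
    · exact tendsto_addEps _
    · exact tendsto_const_nhds
  · simp only [continuation]
    split_ifs
    · exact toENNReal_addEps_le _ _
    · exact le_self_add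
  · obtain ⟨ν, hν, hopt⟩ := exists_epsOptimal_selector hfam.nonempty hfam.analytic htail.borel
      (hδpos n)
    calc value P G x ≤ expect (concatLaw c μ τ ν) G :=
          iInf₂_le _ (hfam.concatenable x μ hμ τ hτ ν hν)
      _ = expect μ (continuation τ (fun y => expect (ν y) G) G) := htail.expect_eq x μ hμ ν hν τ hτ
      _ ≤ _ := expect_mono (continuation_mono (fun y => (hopt y).expect_le) G)

/-- Each conditional cost of a selector is at least `v`, so replacing it by `v` only lowers the
expectation, and some selector nearly reproduces the cost of `μ`. -/
theorem iInf_expect_continuation_le_value (hdis : IsApproxDisintegrable c P T G)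
    {τ : RandomTime E} (hτ : τ ∈ T) (x : E) :
    ⨅ μ ∈ P x, expect μ (continuation τ (value P G) G) ≤ value P G x := by
  refine le_iInf₂ fun μ hμ => ?_
  have h : ∀ ε : ℝ, 0 < ε →
      ⨅ μ ∈ P x, expect μ (continuation τ (value P G) G) ≤ expect μ G + (ε : EReal) := by
    intro ε hε
    obtain ⟨ν, hν, hle⟩ := hdis.disintegrable x μ hμ τ hτ ε hε
    calc ⨅ μ ∈ P x, expect μ (continuation τ (value P G) G)
        ≤ expect μ (continuation τ (value P G) G) := iInf₂_le μ hμ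
      _ ≤ expect μ (continuation τ (fun y => expect (ν y) G) G) :=
          expect_mono (continuation_mono (fun y => iInf₂_le (ν y) (hν y)) G)
      _ = expect (concatLaw c μ τ ν) G := (hdis.tail.expect_eq x μ hμ ν hν τ hτ).symm
      _ ≤ _ := hle
  -- The expectation of `G` may be infinite, so `ε → 0` is carried out against real levels: for `y`
  -- between `expect μ G` and `z`, take `ε = z - y`.
  refine EReal.le_of_forall_lt_iff_le.1 fun z hz => ?_
  obtain ⟨y, hy, hyz⟩ := EReal.lt_iff_exists_real_btwn.1 hz
  refine (h (z - y) (sub_pos.2 (EReal.coe_lt_coe_iff.1 hyz))).trans ?_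
  calc expect μ G + ((z - y : ℝ) : EReal) ≤ (y : EReal) + ((z - y : ℝ) : EReal) := by gcongr
    _ = z := by rw [← EReal.coe_add, add_sub_cancel]

end DPP

end

theorem mainTheorem1 {E : Type*} [TopologicalSpace E] [PolishSpace E] [MeasurableSpace E]
    [BorelSpace E] (c : DPP.Pasting E)
    (P : E → Set (MeasureTheory.ProbabilityMeasure (DPP.Path E)))
    (T : Set (DPP.RandomTime E)) (G : DPP.Path E → EReal)
    (hproblem : DPP.IsMarkovControlProblem c P T G)
    (hdis : DPP.IsApproxDisintegrable c P T G) :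
    (DPP.LowerSemianalytic (DPP.value P G) ∧ DPP.UniversallyMeasurable (DPP.value P G)) ∧
    (∀ ε : ℝ, 0 < ε → ∃ ν ∈ DPP.selectors P, ∀ x, DPP.IsEpsOptimal P G ε x (ν x)) ∧
    (∀ τ ∈ T, ∀ x, DPP.value P G x =
      ⨅ μ ∈ P x, DPP.expect μ (DPP.continuation τ (DPP.value P G) G)) := by
  have hfam := hproblem.family
  have hv := DPP.lowerSemianalytic_value hfam.analytic hdis.tail.borel
  refine ⟨⟨hv, hv.universallyMeasurable⟩, fun ε hε =>
    DPP.exists_epsOptimal_selector hfam.nonempty hfam.analytic hdis.tail.borel hε,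
    fun τ hτ x => le_antisymm ?_ (DPP.iInf_expect_continuation_le_value hdis hτ x)⟩
  exact le_iInf₂ fun μ hμ => DPP.value_le_expect_continuation hfam hdis.tail hτ hμ
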